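/- Let $n,d\ge 1$, $dn\ge 2$, $k\ge 2$, $R>0$, and let $x_1,\dots,x_n\in\mathbb{B}^d(R)=\{x\in\mathbb{R}^d:\|x\|_2\le R\}$ have mean $\bar x=\frac1n\sum_i x_i$ and mean deviation $\sigma^d_{\mathrm{md}}=\frac1n\sum_i\|x_i-\bar x\|_2$. Let $m$ be an integer with $d\le m<2d$ for which an $m\times m$ Hadamard matrix $H$ exists ($m=d$ if there is one of order $d$; otherwise for instance the least power of $2$ above $d$); if $m>d$, attach $m-d$ zeros at the end of every input vector. The estimator WalshHadamardCQ is defined as follows ($\log$ is the natural logarithm). Shared randomness: independent uniform signs on the diagonal of a diagonal matrix $D$, giving $W=\frac1{\sqrt m}HD$; and, independently for each coordinate $j\le m$, a number $c_1^j$ uniform on $[-\frac1k,0)$, which gives the $k$ levels $c_a^j=c_1^j+(a-1)\beta$ with $\beta=\frac{k+1}{k(k-1)}$, $1\le a\le k$, and a uniformly random permutation $\pi^j$ of $\{0,\dots,n-1\}$. Private randomness: independent $\gamma_i^j$, uniform on $[0,\frac1n)$. Client $i$ computes $y_i=\frac{\sqrt m}{R\sqrt{8\log(mn)}}Wx_i$,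 clips every coordinate, $y_i'(j)=\max(-1,\min(y_i(j),1))$, sets $t_i(j)=(y_i'(j)+1)/2\in[0,1]$, lets $c_i'(j)$ be the largest level $c_a^j<t_i(j)$, and quantizes to $$Q_i(j)=-1+2\Big(c_i'(j)+\beta\,\mathbf 1\big[\tfrac{\pi^j_i}{n}+\gamma_i^j<\tfrac{t_i(j)-c_i'(j)}{\beta}\big]\Big).$$ The server forms $z=\frac1n\sum_i Q_i$ and outputs $\hat x=$ the first $d$ coordinates of $\frac{R\sqrt{8\log(mn)}}{\sqrt m}W^{-1}z$. Then, with expectations over all this randomness, $\hat x$ is square-integrable, its bias satisfies $$\|\mathbb{E}\hat x-\bar x\|_2\le\frac{3R\sqrt{2\log(dn)}}{n^2d^{3/2}},$$ and its mean squared error satisfies $$\mathbb{E}\|\hat x-\bar x\|_2^2\le\frac{c\log(dn)}{n}\left(\min\Big(\frac{\sigma^d_{\mathrm{md}}R}{k},\frac{R^2}{k^2}\Big)+\frac{R^2}{nk^2}+\frac{R^2}{n^3d^3}\right),$$ where $c>0$ is a universal constant. Moreover, there is a code (an encoder and a decoder, both allowed to use the shared randomness and depending on no input) with bit strings of a fixed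 length at most $m\log_2 k+1$ (so at most $d\log_2k+1$ when $m=d$), from which the server almost surely recovers every client's quantized vector $Q_i$; so each client sends at most $m\log_2k+1$ bits. -/

import Mathlib

open MeasureTheory ProbabilityTheory

noncomputable section

namespace CorrelatedQuantization

/-! ### The one-dimensional `k`-level correlated quantizer -/

/-- The distance `β = (k + 1) / (k (k - 1))` between consecutive levels. -/
def levelGap (k : ℕ) : ℝ := ((k : ℝ) + 1) / ((k : ℝ) * ((k : ℝ) - 1))

/-- The `k` equally spaced levels `c₁, c₁ + β, …, c₁ + (k - 1) β`, indexed from `0`. -/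
def level (k : ℕ) (c₁ : ℝ) (i : Fin k) : ℝ := c₁ + (i : ℕ) * levelGap k

/-- The largest level strictly below `y` (the supremum is over a finite set, which is nonempty
for `c₁ < 0 ≤ y`). -/
def lowerLevel (k : ℕ) (c₁ y : ℝ) : ℝ :=
  sSup {c : ℝ | (∃ i : Fin k, c = level k c₁ i) ∧ c < y}

/-- The threshold `U_i = π_i / n + γ_i`. -/
def threshold {n : ℕ} (π : Equiv.Perm (Fin n)) (i : Fin n) (γ : ℝ) : ℝ :=
  ((π i : ℕ) : ℝ) / n + γ

/-- The `k`-level quantizer of a point `x ∈ [l, r]`: rescale to `y ∈ [0, 1]`, take the largest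
level `c'` below `y`, and round up to `c' + β` iff the threshold `u` is less than
`(y - c') / β`; finally rescale back to `[l, r]`. -/
def kLevelQuantizer (k : ℕ) (l r c₁ u x : ℝ) : ℝ :=
  let y := (x - l) / (r - l)
  let c' := lowerLevel k c₁ y
  l + (r - l) * (c' + levelGap k * (if u < (y - c') / levelGap k then 1 else 0))

/-! ### Randomness -/

/-- The discrete σ-algebra on the permutations of `{0, …, n - 1}`. -/
instance instMeasurableSpacePerm (n : ℕ) : MeasurableSpace (Equiv.Perm (Fin n)) := ⊤

/-- The randomness shared by the server and all the clients, in (rotated) dimension `m`: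
the signs on the diagonal of `D`, and for every coordinate the lowest level `c₁` and the
permutation `π`. -/
abbrev Shared (n m : ℕ) : Type :=
  (Fin m → Bool) × (Fin m → ℝ) × (Fin m → Equiv.Perm (Fin n))

/-- The private randomness of the `n` clients: `γ i j` is used by client `i` in coordinate `j`. -/
abbrev Private (n m : ℕ) : Type := Fin n → Fin m → ℝ

/-- The uniform distribution on the interval `[a, b)`. -/
def uniformIco (a b : ℝ) : Measure ℝ := ProbabilityTheory.cond volume (Set.Ico a b)

/-- Law of the shared randomness: everything is independent, the signs are fair, the lowest
levels are uniform on `[-1/k, 0)`, and the permutations are uniform. -/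
def sharedLaw (n m k : ℕ) : Measure (Shared n m) :=
  (Measure.pi fun _ => (PMF.uniformOfFintype Bool).toMeasure).prod
    ((Measure.pi fun _ => uniformIco (-(1 / (k : ℝ))) 0).prod
      (Measure.pi fun _ => (PMF.uniformOfFintype (Equiv.Perm (Fin n))).toMeasure))

/-- Law of the private randomness: all the `γ i j` are independent and uniform on `[0, 1/n)`. -/
def privateLaw (n m : ℕ) : Measure (Private n m) :=
  Measure.pi fun _ => Measure.pi fun _ => uniformIco 0 (1 / (n : ℝ))

/-- Joint law of the (independent) shared and private randomness. -/
def law (n m k : ℕ) : Measure (Shared n m × Private n m) :=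
  (sharedLaw n m k).prod (privateLaw n m)

/-! ### The algorithm `WalshHadamardCQ` -/

/-- The random rotation `W = H D / √m`, where `D` is the diagonal matrix of the signs. -/
def rotation {m : ℕ} (H : Matrix (Fin m) (Fin m) ℝ) (s : Fin m → Bool) :
    Matrix (Fin m) (Fin m) ℝ :=
  (1 / √(m : ℝ)) • (H * Matrix.diagonal fun j => if s j then (1 : ℝ) else -1)

/-- Attach `p` zeros at the end of a vector. -/
def padZeros {d : ℕ} (p : ℕ) (x : EuclideanSpace ℝ (Fin d)) : Fin (d + p) → ℝ :=
  Fin.append (fun j => x j) (fun _ => 0)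

/-- The vector `Q_i(x_i)` of quantized coordinates of client `i`, computed from its input `x`,
the shared randomness `ω` and its own private randomness `γ`: pad with zeros to dimension
`m = d + p`, rotate, scale by `√m / (R √(8 log (m n)))`, clip to `[-1, 1]`, and quantize every
coordinate by the `k`-level correlated quantizer on `[-1, 1]`. -/
def clientQuantizer {n d p : ℕ} (H : Matrix (Fin (d + p)) (Fin (d + p)) ℝ) (R : ℝ) (k : ℕ)
    (ω : Shared n (d + p)) (i : Fin n) (γ : Fin (d + p) → ℝ) (x : EuclideanSpace ℝ (Fin d)) :
    Fin (d + p) → ℝ :=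
  let m : ℝ := ((d + p : ℕ) : ℝ)
  let y : Fin (d + p) → ℝ :=
    (√m / (R * √(8 * Real.log (m * n)))) • (rotation H ω.1).mulVec (padZeros p x)
  fun j => kLevelQuantizer k (-1) 1 (ω.2.1 j) (threshold (ω.2.2 j) i (γ j))
    (max (-1) (min (y j) 1))

/-- The server: average the quantized vectors of the clients, undo scaling and rotation, and drop
the `p` padded coordinates. -/
def serverDecode {n d p : ℕ} (H : Matrix (Fin (d + p)) (Fin (d + p)) ℝ) (R : ℝ)
    (ω : Shared n (d + p)) (q : Fin n → Fin (d + p) → ℝ) : EuclideanSpace ℝ (Fin d) :=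
  let m : ℝ := ((d + p : ℕ) : ℝ)
  let z : Fin (d + p) → ℝ := fun j => (1 / (n : ℝ)) * ∑ i, q i j
  let v : Fin (d + p) → ℝ :=
    (R * √(8 * Real.log (m * n)) / √m) • ((rotation H ω.1)⁻¹).mulVec z
  WithLp.toLp 2 fun j => v (Fin.castAdd p j)

/-- The estimate `x̂` returned by `WalshHadamardCQ` on the inputs `x` for the outcome `ω` of the
shared and private randomness. -/
def walshHadamardCQ {n d p : ℕ} (H : Matrix (Fin (d + p)) (Fin (d + p)) ℝ) (R : ℝ) (k : ℕ)
    (x : Fin n → EuclideanSpace ℝ (Fin d)) (ω : Shared n (d + p) × Private n (d + p)) :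
    EuclideanSpace ℝ (Fin d) :=
  serverDecode H R ω.1 fun i => clientQuantizer H R k ω.1 i (ω.2 i) (x i)

/-! ### Mean and mean deviation of the inputs -/

/-- The mean `x̄` of the data points. -/
def mean {n d : ℕ} (x : Fin n → EuclideanSpace ℝ (Fin d)) : EuclideanSpace ℝ (Fin d) :=
  (1 / (n : ℝ)) • ∑ i, x i

/-- The mean deviation `σ = (1/n) ∑ ‖x_i - x̄‖₂`. -/
def meanDeviation {n d : ℕ} (x : Fin n → EuclideanSpace ℝ (Fin d)) : ℝ :=
  (1 / (n : ℝ)) * ∑ i, ‖x i - mean x‖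

end CorrelatedQuantization

end

/-! Since `W` is orthogonal and the server's map is linear, the error splits almost surely as `x̂ -
x̄ = noise + clipping`, the reconstructions of the averaged quantization noise and of the averaged
clipping error (`ae_walshHadamardCQ_eq`).

Noise. In one coordinate the quantizer returns its clipped input plus `2β (1[U < f] - f)`, where `f
∈ (0, 1]` is the position of the input between consecutive levels. Each threshold is uniform on `[0,
1)`, so the noise has mean zero given the signs and the levels. Jointly the thresholds form a
stratified sample, one in each cell of length `1/n`. This makes acceptances negatively correlated,
and their total has variance at most `2 + (1/n) ∑ |f_i - f_j| (1 - |f_i - f_j|)`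
(`integral_sq_sum_accept_sub_le`). The expression `|D| (1 - |D|)` is insensitive to wrapping around
a level, so it is at most `|t_i - t_j| / β`, and also at most `1/4`. Summing over coordinates by
Cauchy-Schwarz and the isometry of `W` turns the first bound into the mean deviation and the second
into `R²/k²`; the constant `2` yields the term `R²/(n k²)`. All this holds for every rotation and
every lowest level.

Clipping. The random signs are needed only here: a scaled rotated coordinate is a Rademacher sum
with variance proxy at most `1/(8 log(mn))`, so its overshoot beyond `[-1, 1]` has second moment of
order `(mn)⁻⁴`. This alone gives the bias, by Jensen's inequality, and the last term of the mean
squared error.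

Communication. Almost surely every coordinate of `Q_i` is one of `k` values known from the shared
randomness, so `⌈m log₂ k⌉` bits suffice. -/

noncomputable section

namespace CorrelatedQuantization

/-! ### Averages over uniform permutations -/

/-- Right multiplication by a transposition shows that the sum does not depend on `i`; summing over
`i` makes every permutation contribute the same total. -/
theorem card_mul_sum_perm_apply {n : ℕ} (a : Fin n → ℝ) (i : Fin n) :
    (n : ℝ) * ∑ π : Equiv.Perm (Fin n), a (π i)
      = (Fintype.card (Equiv.Perm (Fin n)) : ℝ) * ∑ v, a v := by
  have h : ∀ j, ∑ π : Equiv.Perm (Fin n), a (π j) = ∑ π : Equiv.Perm (Fin n), a (π i) := by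
    intro j
    refine Fintype.sum_equiv (Equiv.mulRight (Equiv.swap i j)) _ _ fun π => ?_
    simp
  calc (n : ℝ) * ∑ π : Equiv.Perm (Fin n), a (π i)
      = ∑ j : Fin n, ∑ π : Equiv.Perm (Fin n), a (π j) := by simp [h]
    _ = ∑ π : Equiv.Perm (Fin n), ∑ j : Fin n, a (π j) := Finset.sum_comm
    _ = ∑ π : Equiv.Perm (Fin n), ∑ v, a v :=
        Finset.sum_congr rfl fun π _ => Equiv.sum_comp π a
    _ = _ := by simp

/-- Permutations act transitively on ordered pairs of distinct indices, so all `n (n - 1)` pairs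
give the same sum. Over all these pairs, each permutation contributes the full product minus the
diagonal. -/
theorem card_mul_sum_perm_apply_mul {n : ℕ} (a b : Fin n → ℝ) {i j : Fin n} (hij : i ≠ j) :
    (n : ℝ) * ((n : ℝ) - 1) * ∑ π : Equiv.Perm (Fin n), a (π i) * b (π j)
      = (Fintype.card (Equiv.Perm (Fin n)) : ℝ)
        * ((∑ v, a v) * (∑ v, b v) - ∑ v, a v * b v) := by
  have h : ∀ i' j', i' ≠ j' → ∑ π : Equiv.Perm (Fin n), a (π i') * b (π j')
      = ∑ π : Equiv.Perm (Fin n), a (π i) * b (π j) := by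
    intro i' j' h'
    obtain ⟨σ, hσi, hσj⟩ : ∃ σ : Equiv.Perm (Fin n), σ i = i' ∧ σ j = j' := by
      -- The first swap sends `i` to `i'`; the second sends the image of `j` to `j'` and leaves `i'`
      -- fixed.
      refine ⟨Equiv.swap (Equiv.swap i i' j) j' * Equiv.swap i i', ?_, ?_⟩
      · rw [Equiv.Perm.mul_apply, Equiv.swap_apply_left]
        refine Equiv.swap_apply_of_ne_of_ne ?_ h'
        intro h2
        apply hij
        have h3 := congrArg (Equiv.swap i i') h2
        simpa using h3
      · simp
    refine Fintype.sum_equiv (Equiv.mulRight σ) _ _ fun π => ?_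
    simp [hσi, hσj]
  have key : ∑ i' : Fin n, ∑ j' : Fin n, (if i' = j' then 0 else
      ∑ π : Equiv.Perm (Fin n), a (π i') * b (π j'))
      = (Fintype.card (Equiv.Perm (Fin n)) : ℝ)
        * ((∑ v, a v) * (∑ v, b v) - ∑ v, a v * b v) := by
    have e1 : ∀ i' j' : Fin n, (if i' = j' then 0 else
        ∑ π : Equiv.Perm (Fin n), a (π i') * b (π j'))
        = ∑ π : Equiv.Perm (Fin n),
          (a (π i') * b (π j') - if i' = j' then a (π i') * b (π j') else 0) := by
      intro i' j'
      split_ifs <;> simp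
    simp_rw [e1]
    calc _ = ∑ π : Equiv.Perm (Fin n), ∑ i' : Fin n, ∑ j' : Fin n,
          (a (π i') * b (π j') - if i' = j' then a (π i') * b (π j') else 0) := by
          rw [Finset.sum_comm (s := (Finset.univ : Finset (Equiv.Perm (Fin n))))]
          exact Finset.sum_congr rfl fun i' _ => Finset.sum_comm
      _ = ∑ π : Equiv.Perm (Fin n), ((∑ v, a v) * (∑ v, b v) - ∑ v, a v * b v) := by
          refine Finset.sum_congr rfl fun π _ => ?_
          simp only [Finset.sum_sub_distrib, Finset.sum_ite_eq, Finset.mem_univ, if_true]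
          rw [Equiv.sum_comp π (fun v => a v * b v), ← Finset.sum_mul_sum,
            Equiv.sum_comp π a, Equiv.sum_comp π b]
      _ = _ := by rw [Finset.sum_const, Finset.card_univ, nsmul_eq_mul]
  rw [← key]
  have e2 : ∀ i' j' : Fin n, (if i' = j' then 0 else
      ∑ π : Equiv.Perm (Fin n), a (π i') * b (π j'))
      = (1 - if i' = j' then 1 else 0) * ∑ π : Equiv.Perm (Fin n), a (π i) * b (π j) := by
    intro i' j'
    split_ifs with h'
    · simp
    · simp [h i' j' h']
  simp_rw [e2, ← Finset.sum_mul]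
  simp
  left
  ring

/-! ### Conditional acceptance probabilities -/

/-- The probability that `v / n + γ < a` for `γ` uniform on `[0, 1/n)`. -/
def cellProb (n : ℕ) (a : ℝ) (v : ℕ) : ℝ := max 0 (min 1 (n * a - v))

theorem cellProb_nonneg (n : ℕ) (a : ℝ) (v : ℕ) : 0 ≤ cellProb n a v := le_max_left _ _

theorem cellProb_le_one (n : ℕ) (a : ℝ) (v : ℕ) : cellProb n a v ≤ 1 :=
  max_le zero_le_one (min_le_left _ _)

theorem cellProb_mono (n : ℕ) {a b : ℝ} (h : a ≤ b) (v : ℕ) : cellProb n a v ≤ cellProb n b v := by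
  unfold cellProb
  gcongr

/-- The summands are the lengths of `[0, x] ∩ [v, v + 1]`. -/
theorem sum_range_clamp {x : ℝ} (hx : 0 ≤ x) (N : ℕ) :
    ∑ v ∈ Finset.range N, max 0 (min 1 (x - v)) = min x N := by
  induction N with
  | zero => simp [hx]
  | succ N ih =>
    rw [Finset.sum_range_succ, ih]
    push_cast
    rcases le_total x N with h | h
    · rw [min_eq_left h, min_eq_left (by linarith : x ≤ (N : ℝ) + 1), max_eq_left, add_zero]
      exact (min_le_right _ _).trans (by linarith)
    · rw [min_eq_right h]
      rcases le_total x (N + 1) with h2 | h2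
      · rw [min_eq_left h2, min_eq_right (by linarith), max_eq_right (by linarith)]
        ring
      · rw [min_eq_right h2, min_eq_left (by linarith), max_eq_right (by linarith)]

theorem sum_cellProb {n : ℕ} {a : ℝ} (h0 : 0 ≤ a) (h1 : a ≤ 1) :
    ∑ v : Fin n, cellProb n a v = n * a := by
  unfold cellProb
  rw [Fin.sum_univ_eq_sum_range (fun v => max 0 (min 1 ((n : ℝ) * a - (v : ℝ)))),
    sum_range_clamp (by positivity), min_eq_left]
  exact mul_le_of_le_one_right (Nat.cast_nonneg n) h1

/-- Only the cell containing `a`, with index `⌊n a⌋`, can have a probability other than `0` and `1`.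
-/
theorem sum_cellProb_mul_one_sub_le (n : ℕ) (a : ℝ) :
    ∑ v : Fin n, cellProb n a v * (1 - cellProb n a v) ≤ 1 := by
  rw [Fin.sum_univ_eq_sum_range (fun v => cellProb n a v * (1 - cellProb n a v))]
  calc _ ≤ ∑ v ∈ Finset.range n, (if v = ⌊(n : ℝ) * a⌋₊ then (1 : ℝ) else 0) := by
        refine Finset.sum_le_sum fun v _ => ?_
        have h0 := cellProb_nonneg n a v
        have h1 := cellProb_le_one n a v
        split_ifs with h
        · nlinarith
        · rcases lt_or_ge ((n : ℝ) * a) v with h2 | h2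
          · have : cellProb n a v = 0 :=
              max_eq_left ((min_le_right _ _).trans (by linarith))
            simp [this]
          · have h3 : (v : ℝ) + 1 ≤ n * a := by
              have h4 : v ≤ ⌊(n : ℝ) * a⌋₊ := Nat.le_floor h2
              have h5 : v + 1 ≤ ⌊(n : ℝ) * a⌋₊ := by omega
              have h6 : 0 ≤ (n : ℝ) * a := le_trans (Nat.cast_nonneg v) h2
              have := (Nat.cast_le (α := ℝ).2 h5).trans (Nat.floor_le h6)
              push_cast at this
              exact this
            have : cellProb n a v = 1 := by
              unfold cellProb
              rw [min_eq_left (by linarith), max_eq_right zero_le_one]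
            simp [this]
    _ ≤ 1 := by
        rw [Finset.sum_ite_eq']
        split_ifs <;> norm_num

/-- For `a ≤ b` the sum is at least `∑ p_v²`, where `p_v` is the probability for `a`; this differs
from `∑ p_v = n a` by at most `1`, since at most one cell is split. -/
theorem sum_cellProb_mul_ge {n : ℕ} {a b : ℝ} (ha : 0 ≤ a) (ha1 : a ≤ 1) (hb : 0 ≤ b)
    (hb1 : b ≤ 1) :
    n * min a b - 1 ≤ ∑ v : Fin n, cellProb n a v * cellProb n b v := by
  wlog hab : a ≤ b generalizing a b
  · have := this hb hb1 ha ha1 (le_of_not_ge hab)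
    rw [min_comm]
    simpa only [mul_comm] using this
  rw [min_eq_left hab, ← sum_cellProb ha ha1]
  have h1 := sum_cellProb_mul_one_sub_le n a
  have h2 : ∑ v : Fin n, cellProb n a v * (1 - cellProb n b v)
      ≤ ∑ v : Fin n, cellProb n a v * (1 - cellProb n a v) :=
    Finset.sum_le_sum fun v _ => mul_le_mul_of_nonneg_left
      (by linarith [cellProb_mono n hab v]) (cellProb_nonneg n a v)
  simp only [mul_sub, mul_one, Finset.sum_sub_distrib] at h1 h2 ⊢
  linarith

/-! ### The laws of the permutation and of the private offsets -/

theorem isProbabilityMeasure_uniformIco {a b : ℝ} (h : a < b) :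
    IsProbabilityMeasure (uniformIco a b) :=
  cond_isProbabilityMeasure_of_finite (by simp [h]) (by simp)

theorem ae_uniformIco (a b : ℝ) : ∀ᵐ c ∂uniformIco a b, c ∈ Set.Ico a b :=
  ae_cond_mem measurableSet_Ico

/-- The joint law of the permutation and the offsets of the clients in one coordinate. -/
def thresholdLaw (n : ℕ) : Measure (Equiv.Perm (Fin n) × (Fin n → ℝ)) :=
  (PMF.uniformOfFintype (Equiv.Perm (Fin n))).toMeasure.prod
    (Measure.pi fun _ => uniformIco 0 (1 / (n : ℝ)))

/-- The indicator that the threshold of client `i` is below `a`. -/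
def accept {n : ℕ} (q : Equiv.Perm (Fin n) × (Fin n → ℝ)) (i : Fin n) (a : ℝ) : ℝ :=
  if threshold q.1 i (q.2 i) < a then 1 else 0

theorem isProbabilityMeasure_thresholdLaw {n : ℕ} (hn : 0 < n) :
    IsProbabilityMeasure (thresholdLaw n) := by
  have : IsProbabilityMeasure (uniformIco 0 (1 / (n : ℝ))) :=
    isProbabilityMeasure_uniformIco (by positivity)
  unfold thresholdLaw
  infer_instance

theorem measurable_threshold {n : ℕ} (i : Fin n) :
    Measurable fun q : Equiv.Perm (Fin n) × (Fin n → ℝ) => threshold q.1 i (q.2 i) := by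
  unfold threshold
  have : Measurable fun π : Equiv.Perm (Fin n) => ((π i : ℕ) : ℝ) / n := measurable_of_countable _
  exact (this.comp measurable_fst).add ((measurable_pi_apply i).comp measurable_snd)

theorem measurable_accept {n : ℕ} (i : Fin n) (a : ℝ) :
    Measurable fun q : Equiv.Perm (Fin n) × (Fin n → ℝ) => accept q i a :=
  Measurable.ite (measurableSet_lt (measurable_threshold i) measurable_const)
    measurable_const measurable_const

theorem accept_nonneg {n : ℕ} (q : Equiv.Perm (Fin n) × (Fin n → ℝ)) (i : Fin n) (a : ℝ) :
    0 ≤ accept q i a := by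
  unfold accept; split_ifs <;> norm_num

theorem accept_le_one {n : ℕ} (q : Equiv.Perm (Fin n) × (Fin n → ℝ)) (i : Fin n) (a : ℝ) :
    accept q i a ≤ 1 := by
  unfold accept; split_ifs <;> norm_num

theorem accept_mul_self {n : ℕ} (q : Equiv.Perm (Fin n) × (Fin n → ℝ)) (i : Fin n) (a : ℝ) :
    accept q i a * accept q i a = accept q i a := by
  unfold accept; split_ifs <;> norm_num

theorem integral_uniformIco_indicator {n : ℕ} (hn : 0 < n) (a : ℝ) (v : ℕ) :
    ∫ γ, (if (v : ℝ) / n + γ < a then (1 : ℝ) else 0) ∂uniformIco 0 (1 / (n : ℝ))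
      = cellProb n a v := by
  have hn' : (0 : ℝ) < n := by exact_mod_cast hn
  have e : (fun γ : ℝ => if (v : ℝ) / n + γ < a then (1 : ℝ) else 0)
      = Set.indicator (Set.Iio (a - v / n)) 1 := by
    ext γ
    simp only [Set.indicator, Set.mem_Iio, Pi.one_apply, lt_sub_iff_add_lt']
  rw [e, integral_indicator_one measurableSet_Iio, uniformIco, measureReal_def,
    cond_apply measurableSet_Ico, Set.Ico_inter_Iio]
  simp only [Real.volume_Ico, ENNReal.toReal_mul, ENNReal.toReal_inv, sub_zero]
  rw [ENNReal.toReal_ofReal (by positivity), ENNReal.toReal_ofReal', cellProb, one_div, inv_inv,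
    max_comm, mul_max_of_nonneg _ _ hn'.le, mul_zero, mul_min_of_nonneg _ _ hn'.le]
  congr 2
  · field_simp
  · field_simp

theorem integral_uniform_perm {n : ℕ} (F : Equiv.Perm (Fin n) → ℝ) :
    ∫ π, F π ∂(PMF.uniformOfFintype (Equiv.Perm (Fin n))).toMeasure
      = (Fintype.card (Equiv.Perm (Fin n)) : ℝ)⁻¹ * ∑ π, F π := by
  rw [PMF.integral_eq_sum, Finset.mul_sum]
  simp [PMF.uniformOfFintype_apply]

theorem integrable_of_bdd {α : Type*} [MeasurableSpace α] {μ : Measure α} [IsFiniteMeasure μ]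
    {f : α → ℝ} (hf : Measurable f) (C : ℝ) (h : ∀ x, |f x| ≤ C) : Integrable f μ :=
  Integrable.of_bound hf.aestronglyMeasurable C (Filter.Eventually.of_forall h)

theorem integrable_accept {n : ℕ} (hn : 0 < n) (i : Fin n) (a : ℝ) :
    Integrable (fun q => accept q i a) (thresholdLaw n) := by
  have := isProbabilityMeasure_thresholdLaw hn
  refine integrable_of_bdd (measurable_accept i a) 1 fun q => ?_
  rw [abs_of_nonneg (accept_nonneg q i a)]
  exact accept_le_one q i a

theorem integrable_accept_mul {n : ℕ} (hn : 0 < n) (i j : Fin n) (a b : ℝ) :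
    Integrable (fun q => accept q i a * accept q j b) (thresholdLaw n) := by
  have := isProbabilityMeasure_thresholdLaw hn
  refine integrable_of_bdd ((measurable_accept i a).mul (measurable_accept j b)) 1 fun q => ?_
  rw [abs_of_nonneg (mul_nonneg (accept_nonneg q i a) (accept_nonneg q j b))]
  exact mul_le_one₀ (accept_le_one q i a) (accept_nonneg q j b) (accept_le_one q j b)

theorem integral_accept {n : ℕ} (hn : 0 < n) (i : Fin n) {a : ℝ} (h0 : 0 ≤ a) (h1 : a ≤ 1) :
    ∫ q, accept q i a ∂thresholdLaw n = a := by
  have hp : IsProbabilityMeasure (uniformIco 0 (1 / (n : ℝ))) :=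
    isProbabilityMeasure_uniformIco (by positivity)
  have hn' : (n : ℝ) ≠ 0 := by positivity
  have hi := integrable_accept hn i a
  unfold thresholdLaw at hi ⊢
  rw [integral_prod _ hi]
  have e : ∀ π : Equiv.Perm (Fin n), ∫ γ, accept (π, γ) i a
      ∂(Measure.pi fun _ : Fin n => uniformIco 0 (1 / (n : ℝ))) = cellProb n a (π i) := by
    intro π
    rw [← integral_uniformIco_indicator hn a (π i)]
    exact integral_comp_eval (μ := fun _ : Fin n => uniformIco 0 (1 / (n : ℝ))) (i := i)
      (f := fun g => if ((π i : ℕ) : ℝ) / n + g < a then (1 : ℝ) else 0)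
      (Measurable.ite (measurableSet_lt (by fun_prop) measurable_const)
        measurable_const measurable_const).aestronglyMeasurable
  simp_rw [e]
  rw [integral_uniform_perm]
  have h := card_mul_sum_perm_apply (fun v => cellProb n a v) i
  rw [sum_cellProb h0 h1] at h
  have hc : (Fintype.card (Equiv.Perm (Fin n)) : ℝ) ≠ 0 := by
    exact_mod_cast Fintype.card_ne_zero
  field_simp
  have : (n : ℝ) * ∑ π : Equiv.Perm (Fin n), cellProb n a (π i)
      = n * (Fintype.card (Equiv.Perm (Fin n)) * a) := by rw [h]; ring
  exact mul_left_cancel₀ hn' this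

/-- Given the permutation the offsets are independent, so the probability factors; what remains is
an average over ordered pairs of distinct cells. -/
theorem integral_accept_mul {n : ℕ} (hn : 0 < n) {i j : Fin n} (hij : i ≠ j) {a b : ℝ}
    (ha : 0 ≤ a) (ha1 : a ≤ 1) (hb : 0 ≤ b) (hb1 : b ≤ 1) :
    (n : ℝ) * ((n : ℝ) - 1) * ∫ q, accept q i a * accept q j b ∂thresholdLaw n
      = n * a * (n * b) - ∑ v : Fin n, cellProb n a v * cellProb n b v := by
  have hp : IsProbabilityMeasure (uniformIco 0 (1 / (n : ℝ))) :=
    isProbabilityMeasure_uniformIco (by positivity)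
  have hi := integrable_accept_mul hn i j a b
  unfold thresholdLaw at hi ⊢
  rw [integral_prod _ hi]
  have e : ∀ π : Equiv.Perm (Fin n), ∫ γ, accept (π, γ) i a * accept (π, γ) j b
      ∂(Measure.pi fun _ : Fin n => uniformIco 0 (1 / (n : ℝ)))
      = cellProb n a (π i) * cellProb n b (π j) := by
    intro π
    have hm : ∀ (i : Fin n) (a : ℝ), Measurable
        (fun g : ℝ => if ((π i : ℕ) : ℝ) / n + g < a then (1 : ℝ) else 0) := fun i a =>
      Measurable.ite (measurableSet_lt (by fun_prop) measurable_const)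
        measurable_const measurable_const
    have hind := (iIndepFun_pi (μ := fun _ : Fin n => uniformIco 0 (1 / (n : ℝ)))
      (X := fun _ g => g) (fun _ => aemeasurable_id)).indepFun hij
    have hind2 := hind.comp (hm i a) (hm j b)
    have h3 := hind2.integral_fun_mul_eq_mul_integral
      (((hm i a).comp (measurable_pi_apply i)).aestronglyMeasurable)
      (((hm j b).comp (measurable_pi_apply j)).aestronglyMeasurable)
    rw [← integral_uniformIco_indicator hn a (π i), ← integral_uniformIco_indicator hn b (π j),
      ← integral_comp_eval (μ := fun _ : Fin n => uniformIco 0 (1 / (n : ℝ))) (i := i)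
        (hm i a).aestronglyMeasurable,
      ← integral_comp_eval (μ := fun _ : Fin n => uniformIco 0 (1 / (n : ℝ))) (i := j)
        (hm j b).aestronglyMeasurable]
    exact h3
  simp_rw [e]
  rw [integral_uniform_perm]
  have h := card_mul_sum_perm_apply_mul (fun v => cellProb n a v) (fun v => cellProb n b v) hij
  rw [sum_cellProb ha ha1, sum_cellProb hb hb1] at h
  have hc : (Fintype.card (Equiv.Perm (Fin n)) : ℝ) ≠ 0 := by
    exact_mod_cast Fintype.card_ne_zero
  rw [mul_left_comm, h, inv_mul_cancel_left₀ hc]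

/-! ### Mean and variance of the number of acceptances -/

theorem integral_sum_accept_sub {n : ℕ} (hn : 0 < n) {f : Fin n → ℝ} (h0 : ∀ i, 0 ≤ f i)
    (h1 : ∀ i, f i ≤ 1) :
    ∫ q, ∑ i, (accept q i (f i) - f i) ∂thresholdLaw n = 0 := by
  have := isProbabilityMeasure_thresholdLaw hn
  rw [integral_finsetSum (f := fun i q => accept q i (f i) - f i) _ fun i _ =>
    (integrable_accept hn i (f i)).sub (integrable_const _)]
  refine Finset.sum_eq_zero fun i _ => ?_
  rw [integral_sub (integrable_accept hn i (f i)) (integrable_const _),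
    integral_accept hn i (h0 i) (h1 i)]
  simp

theorem integral_accept_sub_mul {n : ℕ} (hn : 0 < n) (i j : Fin n) {a b : ℝ}
    (ha : 0 ≤ a) (ha1 : a ≤ 1) (hb : 0 ≤ b) (hb1 : b ≤ 1) :
    ∫ q, (accept q i a - a) * (accept q j b - b) ∂thresholdLaw n
      = ∫ q, accept q i a * accept q j b ∂thresholdLaw n - a * b := by
  have := isProbabilityMeasure_thresholdLaw hn
  have e : ∀ q : Equiv.Perm (Fin n) × (Fin n → ℝ), (accept q i a - a) * (accept q j b - b)
      = accept q i a * accept q j b - (b * accept q i a + a * accept q j b - a * b) := by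
    intro q; ring
  simp_rw [e]
  have i1 := (integrable_accept hn i a).const_mul b
  have i2 := (integrable_accept hn j b).const_mul a
  have i12 : Integrable (fun q => b * accept q i a + a * accept q j b) (thresholdLaw n) := i1.add i2
  have i3 : Integrable (fun q => b * accept q i a + a * accept q j b - a * b) (thresholdLaw n) :=
    i12.sub (integrable_const _)
  rw [integral_sub (integrable_accept_mul hn i j a b) i3, integral_sub i12 (integrable_const _),
    integral_add i1 i2, integral_const_mul, integral_const_mul, integral_accept hn i ha ha1,
    integral_accept hn j hb hb1]
  simp
  ring

/-- Two clients never share a cell, which gives covariance at most `(f_i f_j - min(f_i, f_j) + 1/n)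
/ (n - 1)` for `i ≠ j`. Together with the diagonal variances these combine into the pairwise
expression `|D| (1 - |D|)`, which vanishes when all positions agree. -/
theorem integral_sq_sum_accept_sub_le {n : ℕ} (hn : 0 < n) {f : Fin n → ℝ} (h0 : ∀ i, 0 ≤ f i)
    (h1 : ∀ i, f i ≤ 1) :
    ∫ q, (∑ i, (accept q i (f i) - f i)) ^ 2 ∂thresholdLaw n
      ≤ 2 + 1 / n * ∑ i, ∑ j, |f i - f j| * (1 - |f i - f j|) := by
  have := isProbabilityMeasure_thresholdLaw hn
  have hint : ∀ i j, Integrable (fun q => (accept q i (f i) - f i) * (accept q j (f j) - f j))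
      (thresholdLaw n) := by
    intro i j
    have e : ∀ q : Equiv.Perm (Fin n) × (Fin n → ℝ),
        accept q i (f i) * accept q j (f j) - (f j * accept q i (f i) + f i * accept q j (f j)
          - f i * f j) = (accept q i (f i) - f i) * (accept q j (f j) - f j) := by
      intro q; ring
    exact ((integrable_accept_mul hn i j _ _).sub ((((integrable_accept hn i _).const_mul _).add
      ((integrable_accept hn j _).const_mul _)).sub (integrable_const _))).congr
      (Filter.Eventually.of_forall e)
  have e : ∫ q, (∑ i, (accept q i (f i) - f i)) ^ 2 ∂thresholdLaw n
      = ∑ i, ∑ j, (∫ q, accept q i (f i) * accept q j (f j) ∂thresholdLaw n - f i * f j) := by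
    simp_rw [sq, Finset.sum_mul_sum]
    rw [integral_finsetSum _ fun i _ => integrable_finsetSum _ fun j _ => hint i j]
    refine Finset.sum_congr rfl fun i _ => ?_
    rw [integral_finsetSum _ fun j _ => hint i j]
    exact Finset.sum_congr rfl fun j _ =>
      integral_accept_sub_mul hn i j (h0 i) (h1 i) (h0 j) (h1 j)
  rw [e]
  have hdiag : ∀ i, ∫ q, accept q i (f i) * accept q i (f i) ∂thresholdLaw n = f i := by
    intro i
    simp_rw [accept_mul_self]
    exact integral_accept hn i (h0 i) (h1 i)
  have hdelta : ∀ i j, 0 ≤ |f i - f j| * (1 - |f i - f j|) := by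
    intro i j
    refine mul_nonneg (abs_nonneg _) ?_
    have : |f i - f j| ≤ 1 := abs_le.2 ⟨by linarith [h0 i, h1 j], by linarith [h0 j, h1 i]⟩
    linarith
  have hdelta_sum : 0 ≤ ∑ i, ∑ j, |f i - f j| * (1 - |f i - f j|) :=
    Finset.sum_nonneg fun i _ => Finset.sum_nonneg fun j _ => hdelta i j
  -- A single client has no pairs and `n - 1 = 0`; then `f (1 - f) ≤ 2` suffices.
  rcases Nat.lt_or_ge n 2 with h | h2
  · obtain rfl : n = 1 := by omega
    simp only [Fin.sum_univ_one, hdiag]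
    have a0 := h0 0
    have a1 := h1 0
    simp
    nlinarith
  have hn2 : (2 : ℝ) ≤ n := by exact_mod_cast h2
  have hn1 : (0 : ℝ) < n - 1 := by linarith
  -- The off-diagonal bound is extended to the diagonal, where the correction term restores the
  -- variance `f (1 - f)`; this allows summation over all pairs.
  have hcov : ∀ i j, ∫ q, accept q i (f i) * accept q j (f j) ∂thresholdLaw n - f i * f j
      ≤ (f i * f j - min (f i) (f j) + 1 / n) / (n - 1)
        + if i = j then f i * (1 - f i) * (n / (n - 1)) else 0 := by
    intro i j
    split_ifs with hij
    · subst hij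
      rw [hdiag, min_self]
      have : f i - f i * f i = (f i * f i - f i) / (n - 1) + f i * (1 - f i) * (n / (n - 1)) := by
        field_simp; ring
      have h3 : (f i * f i - f i) / ((n : ℝ) - 1) ≤ (f i * f i - f i + 1 / n) / (n - 1) := by
        gcongr
        simp
      linarith
    · have h3 := integral_accept_mul hn hij (h0 i) (h1 i) (h0 j) (h1 j)
      have h4 := sum_cellProb_mul_ge (n := n) (h0 i) (h1 i) (h0 j) (h1 j)
      set I := ∫ q, accept q i (f i) * accept q j (f j) ∂thresholdLaw n
      rw [add_zero, le_div_iff₀ hn1]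
      have h5 : n * ((I - f i * f j) * (n - 1)) ≤ n * (f i * f j - min (f i) (f j) + 1 / n) := by
        have : (n : ℝ) * (f i * f j - min (f i) (f j) + 1 / n)
          = n * (f i * f j) - n * min (f i) (f j) + 1 := by field_simp
        rw [this]
        linarith
      exact le_of_mul_le_mul_left h5 (by linarith)
  have hpair : ∀ i j, |f i - f j| * (1 - |f i - f j|)
      = f i * (1 - f i) + f j * (1 - f j) + 2 * (f i * f j - min (f i) (f j)) := by
    intro i j
    rcases le_total (f i) (f j) with h | h
    · rw [abs_of_nonpos (by linarith), min_eq_left h]; ring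
    · rw [abs_of_nonneg (by linarith), min_eq_right h]; ring
  have hM : ∑ i, ∑ j, |f i - f j| * (1 - |f i - f j|)
      = 2 * n * ∑ i, f i * (1 - f i) + 2 * ∑ i, ∑ j, (f i * f j - min (f i) (f j)) := by
    have e3 : ∑ i, ∑ j, 2 * (f i * f j - min (f i) (f j))
        = 2 * ∑ i, ∑ j, (f i * f j - min (f i) (f j)) := by simp only [Finset.mul_sum]
    simp only [hpair, Finset.sum_add_distrib, Finset.sum_const, Finset.card_univ,
      Fintype.card_fin, nsmul_eq_mul]
    rw [e3, ← Finset.mul_sum]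
    ring
  set M := ∑ i, ∑ j, |f i - f j| * (1 - |f i - f j|)
  calc _ ≤ ∑ i, ∑ j, ((f i * f j - min (f i) (f j) + 1 / n) / (n - 1)
        + if i = j then f i * (1 - f i) * ((n : ℝ) / (n - 1)) else 0) :=
        Finset.sum_le_sum fun i _ => Finset.sum_le_sum fun j _ => hcov i j
    _ = (∑ i, ∑ j, (f i * f j - min (f i) (f j)) + n) / (n - 1)
        + (∑ i, f i * (1 - f i)) * ((n : ℝ) / (n - 1)) := by
        simp only [Finset.sum_add_distrib, Finset.sum_ite_eq, Finset.mem_univ, if_true,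
          ← Finset.sum_div, ← Finset.sum_mul]
        simp
    _ = n / (n - 1) + 1 / (2 * (n - 1)) * M := by
        rw [hM]; field_simp; ring
    -- For `n ≥ 2`, `n / (n - 1) ≤ 2` and `2 (n - 1) ≥ n`.
    _ ≤ _ := by
        gcongr
        · rw [div_le_iff₀ hn1]; linarith
        · linarith

/-! ### The quantizer in terms of the position between consecutive levels -/

theorem levelGap_pos {k : ℕ} (hk : 2 ≤ k) : 0 < levelGap k := by
  have : (2 : ℝ) ≤ k := by exact_mod_cast hk
  unfold levelGap
  have : (0 : ℝ) < k - 1 := by linarith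
  positivity

theorem levelGap_le {k : ℕ} (hk : 2 ≤ k) : levelGap k ≤ 3 / k := by
  have : (2 : ℝ) ≤ k := by exact_mod_cast hk
  have h1 : (0 : ℝ) < k - 1 := by linarith
  unfold levelGap
  rw [div_le_div_iff₀ (by positivity) (by positivity)]
  nlinarith

/-- The representative in `(0, 1]` of `r` modulo `1`. -/
def upperFract (r : ℝ) : ℝ := r - ⌈r⌉ + 1

theorem upperFract_pos (r : ℝ) : 0 < upperFract r := by
  unfold upperFract; linarith [Int.ceil_lt_add_one r]

theorem upperFract_le_one (r : ℝ) : upperFract r ≤ 1 := by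
  unfold upperFract; linarith [Int.le_ceil r]

theorem measurable_upperFract : Measurable upperFract := by
  unfold upperFract
  have : Measurable fun r : ℝ => (⌈r⌉ : ℝ) :=
    (measurable_of_countable (fun z : ℤ => (z : ℝ))).comp Int.measurable_ceil
  fun_prop

/-- The difference `r - s` is `D + z` with `z` an integer. If `z = 0` it is `D` itself; otherwise
`|D + z| ≥ 1 - |D|`. Either factor of the left side can thus be the one that is kept. -/
theorem abs_upperFract_sub_mul_le (r s : ℝ) :
    |upperFract r - upperFract s| * (1 - |upperFract r - upperFract s|) ≤ |r - s| := by
  have h1 := upperFract_pos r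
  have h2 := upperFract_le_one r
  have h3 := upperFract_pos s
  have h4 := upperFract_le_one s
  have hD : |upperFract r - upperFract s| ≤ 1 := abs_le.2 ⟨by linarith, by linarith⟩
  have hD0 := abs_nonneg (upperFract r - upperFract s)
  obtain ⟨z, hz⟩ : ∃ z : ℤ, r - s = upperFract r - upperFract s + z :=
    ⟨⌈r⌉ - ⌈s⌉, by unfold upperFract; push_cast; ring⟩
  rw [hz]
  set D := upperFract r - upperFract s
  rcases lt_trichotomy z 0 with h | rfl | h
  · have : (z : ℝ) ≤ -1 := by exact_mod_cast Int.le_sub_one_of_lt h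
    have h5 : 1 - |D| ≤ |D + z| := by
      linarith [le_abs_self D, neg_le_abs (D + z)]
    nlinarith
  · simp
    nlinarith
  · have : (1 : ℝ) ≤ z := by exact_mod_cast h
    have h5 : 1 - |D| ≤ |D + z| := by
      linarith [neg_abs_le D, le_abs_self (D + z)]
    nlinarith

/-- The gap satisfies `(k - 1) β = 1 + 1/k`, so the levels start below `0` and the last one is at
least `1`. Hence the level below `y` is never the last, and rounding up stays among the levels. -/
theorem exists_lowerLevel_eq {k : ℕ} (hk : 2 ≤ k) {c y : ℝ}
    (hc : c ∈ Set.Ico (-(1 / (k : ℝ))) 0) (hy0 : 0 ≤ y) (hy1 : y ≤ 1) :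
    ∃ i : Fin k, (i : ℕ) + 1 < k ∧ lowerLevel k c y = level k c i ∧
      ((i : ℕ) : ℝ) = ⌈(y - c) / levelGap k⌉ - 1 := by
  have hk' : (2 : ℝ) ≤ k := by exact_mod_cast hk
  have hβ := levelGap_pos hk
  set r := (y - c) / levelGap k with hr
  have hr0 : 0 < r := div_pos (by linarith [hc.2]) hβ
  have hr1 : r ≤ k - 1 := by
    rw [hr, div_le_iff₀ hβ]
    have : ((k : ℝ) - 1) * levelGap k = 1 + 1 / k := by
      have : (k : ℝ) - 1 ≠ 0 := by linarith
      unfold levelGap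
      field_simp
    rw [this]
    linarith [hc.1]
  have hN0 : 0 < ⌈r⌉ := Int.ceil_pos.2 hr0
  have hN1 : ⌈r⌉ ≤ (k : ℤ) - 1 := Int.ceil_le.2 (by push_cast; exact hr1)
  obtain ⟨N, hN⟩ : ∃ N : ℕ, (N : ℤ) = ⌈r⌉ - 1 := ⟨(⌈r⌉ - 1).toNat, by omega⟩
  have hNr : (N : ℝ) = ⌈r⌉ - 1 := by exact_mod_cast hN
  refine ⟨⟨N, by omega⟩, by simp only; omega, ?_, hNr⟩
  refine IsGreatest.csSup_eq ⟨⟨⟨_, rfl⟩, ?_⟩, ?_⟩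
  · have h1 : (N : ℝ) < r := by rw [hNr]; linarith [Int.ceil_lt_add_one r]
    rw [hr, lt_div_iff₀ hβ] at h1
    simp only [level]
    linarith
  · rintro _ ⟨⟨j, rfl⟩, hj⟩
    simp only [level] at hj ⊢
    have h1 : ((j : ℕ) : ℝ) < r := by
      rw [hr, lt_div_iff₀ hβ]; linarith
    have h2 : ((j : ℕ) : ℤ) < ⌈r⌉ := Int.lt_ceil.2 (by exact_mod_cast h1)
    have h3 : ((j : ℕ) : ℝ) ≤ N := by
      exact_mod_cast (show (j : ℕ) ≤ N by omega)
    gcongr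

/-- The chosen level is strictly below the input, so the relative position lies in `(0, 1]` and is
given by `upperFract` rather than by the usual fractional part. -/
theorem kLevelQuantizer_eq {k : ℕ} (hk : 2 ≤ k) {c x : ℝ} (u : ℝ)
    (hc : c ∈ Set.Ico (-(1 / (k : ℝ))) 0) (hx0 : -1 ≤ x) (hx1 : x ≤ 1) :
    kLevelQuantizer k (-1) 1 c u x = x + 2 * levelGap k *
      ((if u < upperFract (((x + 1) / 2 - c) / levelGap k) then 1 else 0)
        - upperFract (((x + 1) / 2 - c) / levelGap k)) := by
  have hβ := levelGap_pos hk
  obtain ⟨i, -, hi, hi'⟩ := exists_lowerLevel_eq hk hc (y := (x + 1) / 2) (by linarith)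
    (by linarith)
  have e : (x - -1) / (1 - -1) = (x + 1) / 2 := by norm_num
  unfold kLevelQuantizer
  simp only [e]
  rw [hi]
  have e2 : level k c i = (x + 1) / 2 - levelGap k * upperFract (((x + 1) / 2 - c) / levelGap k) := by
    unfold level upperFract
    rw [hi']
    field_simp
    ring
  rw [e2]
  have e3 : ((x + 1) / 2 - ((x + 1) / 2 - levelGap k *
      upperFract (((x + 1) / 2 - c) / levelGap k))) / levelGap k
      = upperFract (((x + 1) / 2 - c) / levelGap k) := by
    field_simp
    ring
  rw [e3]
  ring

theorem exists_kLevelQuantizer_eq_level {k : ℕ} (hk : 2 ≤ k) {c x : ℝ} (u : ℝ)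
    (hc : c ∈ Set.Ico (-(1 / (k : ℝ))) 0) (hx0 : -1 ≤ x) (hx1 : x ≤ 1) :
    ∃ a : Fin k, kLevelQuantizer k (-1) 1 c u x = -1 + 2 * level k c a := by
  obtain ⟨i, hik, hi, -⟩ := exists_lowerLevel_eq hk hc (y := (x + 1) / 2) (by linarith)
    (by linarith)
  have e : (x - -1) / (1 - -1) = (x + 1) / 2 := by norm_num
  unfold kLevelQuantizer
  simp only [e]
  rw [hi]
  split_ifs
  · exact ⟨⟨i + 1, hik⟩, by simp only [level]; push_cast; ring⟩
  · exact ⟨i, by ring⟩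

/-! ### Quantization error in one coordinate -/

/-- The total deviation of the acceptances from their means, for points `t` and lowest level `c`. -/
def roundingError {n : ℕ} (k : ℕ) (t : Fin n → ℝ) (c : ℝ)
    (q : Equiv.Perm (Fin n) × (Fin n → ℝ)) : ℝ :=
  ∑ i, (accept q i (upperFract ((t i - c) / levelGap k)) - upperFract ((t i - c) / levelGap k))

theorem abs_roundingError_le {n : ℕ} (k : ℕ) (t : Fin n → ℝ) (c : ℝ)
    (q : Equiv.Perm (Fin n) × (Fin n → ℝ)) : |roundingError k t c q| ≤ n := by
  calc |roundingError k t c q| ≤ ∑ _i : Fin n, (1 : ℝ) := by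
        refine (Finset.abs_sum_le_sum_abs _ _).trans (Finset.sum_le_sum fun i _ => ?_)
        have h1 := upperFract_pos ((t i - c) / levelGap k)
        have h2 := upperFract_le_one ((t i - c) / levelGap k)
        have h3 := accept_nonneg q i (upperFract ((t i - c) / levelGap k))
        have h4 := accept_le_one q i (upperFract ((t i - c) / levelGap k))
        exact abs_le.2 ⟨by linarith, by linarith⟩
    _ = n := by simp

theorem measurable_roundingError {α : Type*} [MeasurableSpace α] {n : ℕ} (k : ℕ)
    {t : α → Fin n → ℝ} (ht : ∀ i, Measurable fun a => t a i) {c : α → ℝ} (hc : Measurable c)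
    {q : α → Equiv.Perm (Fin n) × (Fin n → ℝ)} (hq : Measurable q) :
    Measurable fun a => roundingError k (t a) (c a) (q a) := by
  unfold roundingError
  refine Finset.measurable_sum _ fun i _ => ?_
  have hf : Measurable fun a => upperFract ((t a i - c a) / levelGap k) :=
    measurable_upperFract.comp (((ht i).sub hc).div_const _)
  refine Measurable.sub (Measurable.ite (measurableSet_lt ((measurable_threshold i).comp hq) hf)
    measurable_const measurable_const) hf

theorem integral_roundingError {n : ℕ} (hn : 0 < n) (k : ℕ) (t : Fin n → ℝ) (c : ℝ) :
    ∫ q, roundingError k t c q ∂thresholdLaw n = 0 :=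
  integral_sum_accept_sub hn (fun _ => (upperFract_pos _).le) (fun _ => upperFract_le_one _)

/-- The `1/4` is the maximum of `D (1 - D)`; in the other bound `c` cancels from the difference of
positions, so the estimate is uniform in `c`. -/
theorem integral_sq_roundingError_le {n k : ℕ} (hn : 0 < n) (hk : 2 ≤ k) (t : Fin n → ℝ) (c : ℝ) :
    ∫ q, roundingError k t c q ^ 2 ∂thresholdLaw n
      ≤ 2 + 1 / n * ∑ i, ∑ j, min (1 / 4) (|t i - t j| / levelGap k) := by
  refine (integral_sq_sum_accept_sub_le hn (fun _ => (upperFract_pos _).le)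
    (fun _ => upperFract_le_one _)).trans ?_
  gcongr with i _ j _
  refine le_min ?_ ?_
  · nlinarith [sq_nonneg (|upperFract ((t i - c) / levelGap k)
      - upperFract ((t j - c) / levelGap k)| - 1 / 2)]
  · refine (abs_upperFract_sub_mul_le _ _).trans (le_of_eq ?_)
    rw [← sub_div, abs_div, abs_of_pos (levelGap_pos hk)]
    ring_nf

/-! ### Clipping of Rademacher sums -/

/-- Clipping to `[-1, 1]`. -/
def clip (y : ℝ) : ℝ := max (-1) (min y 1)

theorem neg_one_le_clip (y : ℝ) : -1 ≤ clip y := le_max_left _ _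

theorem clip_le_one (y : ℝ) : clip y ≤ 1 := max_le (by norm_num) (min_le_right _ _)

theorem abs_clip_sub_clip_le (y z : ℝ) : |clip y - clip z| ≤ |y - z| := by
  unfold clip
  rw [max_comm (-1), max_comm (-1)]
  exact (abs_max_sub_max_le_abs _ _ _).trans ((abs_min_sub_min_le_max _ _ _ _).trans (by simp))

/-- An overshoot `v = |y| - 1 ≥ 0` satisfies `v² ≤ (2 / l²) exp(l v)`, because `exp u ≥ u² / 2` for
`u ≥ 0`; the two exponentials serve the two signs of `y`. -/
theorem sq_clip_sub_le (y : ℝ) {l : ℝ} (hl : 0 < l) :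
    (clip y - y) ^ 2 ≤ 2 / l ^ 2 * Real.exp (-l) * (Real.exp (l * y) + Real.exp (-(l * y))) := by
  have key : ∀ v : ℝ, 0 ≤ v → v ^ 2 ≤ 2 / l ^ 2 * Real.exp (l * v) := by
    intro v hv
    have h := Real.quadratic_le_exp_of_nonneg (mul_nonneg hl.le hv)
    rw [div_mul_eq_mul_div, le_div_iff₀ (by positivity)]
    nlinarith [mul_nonneg hl.le hv]
  have hpos : ∀ z : ℝ, 0 ≤ 2 / l ^ 2 * Real.exp (-l) * Real.exp z := fun z => by positivity
  rcases le_total y (-1) with h | h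
  · have e : clip y = -1 := by
      unfold clip; rw [min_eq_left (by linarith), max_eq_left h]
    have h1 := key (-1 - y) (by linarith)
    have e2 : l * (-1 - y) = -l + -(l * y) := by ring
    rw [e2, Real.exp_add] at h1
    rw [e, mul_add]
    linarith [hpos (l * y)]
  rcases le_total y 1 with h' | h'
  · have e : clip y = y := by
      unfold clip; rw [min_eq_left h', max_eq_right h]
    rw [e, sub_self, mul_add]
    have := hpos (l * y)
    have := hpos (-(l * y))
    simp only [ne_eq, OfNat.ofNat_ne_zero, not_false_eq_true, zero_pow]
    linarith
  · have e : clip y = 1 := by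
      unfold clip; rw [min_eq_right h', max_eq_right (by norm_num)]
    have h1 := key (y - 1) (by linarith)
    have e2 : l * (y - 1) = -l + l * y := by ring
    rw [e2, Real.exp_add] at h1
    rw [e, mul_add]
    have e3 : (1 - y) ^ 2 = (y - 1) ^ 2 := by ring
    rw [e3]
    linarith [hpos (-(l * y))]

/-- The law of independent fair signs. -/
def signLaw (m : ℕ) : Measure (Fin m → Bool) :=
  Measure.pi fun _ => (PMF.uniformOfFintype Bool).toMeasure

instance isProbabilityMeasure_signLaw (m : ℕ) : IsProbabilityMeasure (signLaw m) := by
  unfold signLaw; infer_instance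

/-- The sign encoded by a Boolean. -/
def boolSign (b : Bool) : ℝ := if b then 1 else -1

theorem integral_exp_rademacher_le {m : ℕ} (a : Fin m → ℝ) :
    ∫ s, Real.exp (∑ l, a l * boolSign (s l)) ∂signLaw m ≤ Real.exp ((∑ l, a l ^ 2) / 2) := by
  simp_rw [Real.exp_sum]
  unfold signLaw
  rw [integral_fintype_prod_eq_prod (f := fun l b => Real.exp (a l * boolSign b)),
    Finset.sum_div, Real.exp_sum]
  refine Finset.prod_le_prod (fun l _ => integral_nonneg fun b => (Real.exp_pos _).le)
    fun l _ => ?_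
  refine le_trans (le_of_eq ?_) (Real.cosh_le_exp_half_sq (a l))
  rw [PMF.integral_eq_sum, Real.cosh_eq]
  simp [PMF.uniformOfFintype_apply, boolSign]
  ring

/-- The exponent `-l + l² / (16 L)` of the Chernoff-type bound is minimal at `l = 8 L`, with value
`-4 L`. -/
theorem integral_sq_clip_rademacher_sub_le {m : ℕ} (a : Fin m → ℝ) {L : ℝ} (hL : 0 < L)
    (ha : ∑ l, a l ^ 2 ≤ 1 / (8 * L)) :
    ∫ s, (clip (∑ l, a l * boolSign (s l)) - ∑ l, a l * boolSign (s l)) ^ 2 ∂signLaw m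
      ≤ 1 / (16 * L ^ 2) * Real.exp (-(4 * L)) := by
  have h8 : 0 < 8 * L := by positivity
  have hexp : ∀ b : Fin m → ℝ, ∑ l, b l ^ 2 ≤ 8 * L →
      ∫ s, Real.exp (∑ l, b l * boolSign (s l)) ∂signLaw m ≤ Real.exp (4 * L) := fun b hb =>
    (integral_exp_rademacher_le b).trans (Real.exp_le_exp.2 (by linarith))
  have hsq : ∑ l, (8 * L * a l) ^ 2 ≤ 8 * L := by
    simp_rw [mul_pow, ← Finset.mul_sum]
    calc (8 ^ 2 * L ^ 2) * ∑ l, a l ^ 2 ≤ (8 ^ 2 * L ^ 2) * (1 / (8 * L)) := by gcongr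
      _ = 8 * L := by field_simp
  have h1 := hexp (fun l => 8 * L * a l) hsq
  have h2 := hexp (fun l => -(8 * L * a l)) (by simpa only [neg_sq] using hsq)
  calc _ ≤ ∫ s, 2 / (8 * L) ^ 2 * Real.exp (-(8 * L))
        * (Real.exp (∑ l, 8 * L * a l * boolSign (s l))
          + Real.exp (∑ l, -(8 * L * a l) * boolSign (s l))) ∂signLaw m := by
        refine integral_mono .of_finite .of_finite fun s => ?_
        refine (sq_clip_sub_le _ h8).trans (le_of_eq ?_)
        simp only [Finset.mul_sum, neg_mul, Finset.sum_neg_distrib, mul_assoc]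
    _ ≤ 2 / (8 * L) ^ 2 * Real.exp (-(8 * L)) * (Real.exp (4 * L) + Real.exp (4 * L)) := by
        rw [integral_const_mul, integral_add .of_finite .of_finite]
        gcongr
    _ = 1 / (16 * L ^ 2) * (Real.exp (-(8 * L)) * Real.exp (4 * L)) := by
        field_simp; ring
    _ = _ := by rw [← Real.exp_add]; ring_nf

/-! ### The rotation -/

theorem rotation_apply {m : ℕ} (H : Matrix (Fin m) (Fin m) ℝ) (s : Fin m → Bool) (i j : Fin m) :
    rotation H s i j = 1 / √(m : ℝ) * (H i j * boolSign (s j)) := by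
  simp [rotation, boolSign, Matrix.mul_diagonal]

theorem rotation_mul_transpose {m : ℕ} (hm : 0 < m) {H : Matrix (Fin m) (Fin m) ℝ}
    (hH : H.IsHadamard) (s : Fin m → Bool) :
    rotation H s * (rotation H s).transpose = 1 := by
  have hm' : (0 : ℝ) < m := by exact_mod_cast hm
  have h := hH.mul_conjTranspose
  ext i j
  have hij := congrFun (congrFun h i) j
  simp only [Matrix.mul_apply, Matrix.conjTranspose_apply, star_trivial, Matrix.smul_apply,
    Fintype.card_fin, smul_eq_mul] at hij
  simp only [Matrix.mul_apply, Matrix.transpose_apply, rotation_apply]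
  have e : ∀ l, 1 / √(m : ℝ) * (H i l * boolSign (s l)) * (1 / √(m : ℝ) * (H j l * boolSign (s l)))
      = 1 / m * (H i l * H j l) := by
    intro l
    have h1 : boolSign (s l) * boolSign (s l) = 1 := by
      unfold boolSign; split_ifs <;> norm_num
    have h2 : √(m : ℝ) * √(m : ℝ) = m := Real.mul_self_sqrt hm'.le
    calc _ = 1 / (√(m : ℝ) * √(m : ℝ)) * (H i l * H j l) * (boolSign (s l) * boolSign (s l)) := by
          field_simp
      _ = _ := by rw [h1, h2, mul_one]
  simp_rw [e]
  rw [← Finset.mul_sum, hij]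
  field_simp

theorem rotation_inv {m : ℕ} (hm : 0 < m) {H : Matrix (Fin m) (Fin m) ℝ}
    (hH : H.IsHadamard) (s : Fin m → Bool) :
    (rotation H s)⁻¹ = (rotation H s).transpose :=
  Matrix.inv_eq_right_inv (rotation_mul_transpose hm hH s)

theorem transpose_mul_rotation {m : ℕ} (hm : 0 < m) {H : Matrix (Fin m) (Fin m) ℝ}
    (hH : H.IsHadamard) (s : Fin m → Bool) :
    (rotation H s).transpose * rotation H s = 1 :=
  mul_eq_one_comm.1 (rotation_mul_transpose hm hH s)

theorem sum_sq_mulVec {m : ℕ} {A : Matrix (Fin m) (Fin m) ℝ} (hA : A.transpose * A = 1)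
    (v : Fin m → ℝ) : ∑ j, (A.mulVec v) j ^ 2 = ∑ j, v j ^ 2 := by
  have e : ∀ w : Fin m → ℝ, ∑ j, w j ^ 2 = w ⬝ᵥ w := fun w => by simp [dotProduct, sq]
  rw [e, e, Matrix.dotProduct_mulVec, Matrix.vecMul_mulVec, hA, Matrix.vecMul_one]

theorem hadamard_sq {m : ℕ} {H : Matrix (Fin m) (Fin m) ℝ} (hH : H.IsHadamard) (i j : Fin m) :
    H i j ^ 2 = 1 := by
  have := (Unitary.mem_iff.1 (hH.apply_mem i j)).1
  rw [star_trivial] at this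
  rw [sq, this]

/-! ### Scaled rotated inputs and their reconstruction -/

/-- The scaled rotated input `(√m / (R √(8 log (m n)))) W v`. -/
def rotated {d p : ℕ} (H : Matrix (Fin (d + p)) (Fin (d + p)) ℝ) (R : ℝ) (n : ℕ)
    (s : Fin (d + p) → Bool) (v : EuclideanSpace ℝ (Fin d)) : Fin (d + p) → ℝ :=
  (√((d + p : ℕ) : ℝ) / (R * √(8 * Real.log (((d + p : ℕ) : ℝ) * n)))) •
    (rotation H s).mulVec (padZeros p v)

/-- The reconstruction: undo scaling and rotation and drop the padded coordinates. -/
def unrotate {d p : ℕ} (H : Matrix (Fin (d + p)) (Fin (d + p)) ℝ) (R : ℝ) (n : ℕ)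
    (s : Fin (d + p) → Bool) (z : Fin (d + p) → ℝ) : EuclideanSpace ℝ (Fin d) :=
  WithLp.toLp 2 fun j => ((R * √(8 * Real.log (((d + p : ℕ) : ℝ) * n)) / √((d + p : ℕ) : ℝ)) •
    ((rotation H s)⁻¹).mulVec z) (Fin.castAdd p j)

section

variable {n d p : ℕ} {H : Matrix (Fin (d + p)) (Fin (d + p)) ℝ} {R : ℝ}

theorem sum_sq_padZeros (v : EuclideanSpace ℝ (Fin d)) : ∑ j, padZeros p v j ^ 2 = ‖v‖ ^ 2 := by
  rw [EuclideanSpace.norm_sq_eq, Fin.sum_univ_add]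
  simp [padZeros]

theorem rotated_apply (s : Fin (d + p) → Bool) (v : EuclideanSpace ℝ (Fin d)) (j : Fin (d + p)) :
    rotated H R n s v j = ∑ l : Fin d,
      (√((d + p : ℕ) : ℝ) / (R * √(8 * Real.log (((d + p : ℕ) : ℝ) * n)))
        * rotation H s j (Fin.castAdd p l)) * v l := by
  simp only [rotated, Pi.smul_apply, smul_eq_mul, Matrix.mulVec, dotProduct]
  rw [Fin.sum_univ_add]
  simp [padZeros, Finset.mul_sum, mul_assoc]

theorem rotated_sub (s : Fin (d + p) → Bool) (v w : EuclideanSpace ℝ (Fin d)) (j : Fin (d + p)) :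
    rotated H R n s (v - w) j = rotated H R n s v j - rotated H R n s w j := by
  simp only [rotated_apply, ← Finset.sum_sub_distrib, PiLp.sub_apply, mul_sub]

theorem rotated_mean (s : Fin (d + p) → Bool) (x : Fin n → EuclideanSpace ℝ (Fin d))
    (j : Fin (d + p)) :
    rotated H R n s (mean x) j = 1 / (n : ℝ) * ∑ i, rotated H R n s (x i) j := by
  simp only [rotated_apply]
  rw [Finset.sum_comm, Finset.mul_sum]
  refine Finset.sum_congr rfl fun l _ => ?_
  rw [← Finset.mul_sum, mul_left_comm]
  simp [mean]

theorem sum_sq_rotated (hd : 0 < d + p) (hH : H.IsHadamard) (s : Fin (d + p) → Bool)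
    (v : EuclideanSpace ℝ (Fin d)) :
    ∑ j, rotated H R n s v j ^ 2
      = (√((d + p : ℕ) : ℝ) / (R * √(8 * Real.log (((d + p : ℕ) : ℝ) * n))) * ‖v‖) ^ 2 := by
  simp only [rotated, Pi.smul_apply, smul_eq_mul, mul_pow]
  rw [← Finset.mul_sum, sum_sq_mulVec (transpose_mul_rotation hd hH s), sum_sq_padZeros]

/-- The factor `√m` of the scaling cancels that of the rotation, and the entries of `H` are `±1`; so
the squared coefficients add up to `‖v‖² / (8 R² log(mn))`. -/
theorem rotated_eq_rademacher (hd : 0 < d + p) (hR : 0 < R) (hH : H.IsHadamard)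
    (hL : 0 < Real.log (((d + p : ℕ) : ℝ) * n))
    {v : EuclideanSpace ℝ (Fin d)} (hv : ‖v‖ ≤ R) (j : Fin (d + p)) :
    ∃ a : Fin (d + p) → ℝ, (∀ s, rotated H R n s v j = ∑ l, a l * boolSign (s l)) ∧
      ∑ l, a l ^ 2 ≤ 1 / (8 * Real.log (((d + p : ℕ) : ℝ) * n)) := by
  have hm : (0 : ℝ) < ((d + p : ℕ) : ℝ) := by exact_mod_cast hd
  refine ⟨fun l => 1 / (R * √(8 * Real.log (((d + p : ℕ) : ℝ) * n))) * (H j l * padZeros p v l),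
    fun s => ?_, ?_⟩
  · simp only [rotated, Pi.smul_apply, smul_eq_mul, Matrix.mulVec, dotProduct, rotation_apply,
      Finset.mul_sum]
    refine Finset.sum_congr rfl fun l _ => ?_
    have := Real.sqrt_pos.2 hm
    field_simp
  · simp only [mul_pow, hadamard_sq hH, one_mul, ← Finset.mul_sum, sum_sq_padZeros]
    rw [div_pow, mul_pow, Real.sq_sqrt (by positivity)]
    calc _ ≤ 1 ^ 2 / (R ^ 2 * (8 * Real.log (((d + p : ℕ) : ℝ) * n))) * R ^ 2 := by gcongr
      _ = _ := by field_simp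

theorem unrotate_apply (s : Fin (d + p) → Bool) (z : Fin (d + p) → ℝ) (l : Fin d) :
    unrotate H R n s z l = ∑ j, (R * √(8 * Real.log (((d + p : ℕ) : ℝ) * n)) / √((d + p : ℕ) : ℝ)
      * (rotation H s)⁻¹ (Fin.castAdd p l) j) * z j := by
  simp [unrotate, Matrix.mulVec, dotProduct, Finset.mul_sum, mul_assoc]

theorem unrotate_add (s : Fin (d + p) → Bool) (z w : Fin (d + p) → ℝ) :
    unrotate H R n s (fun j => z j + w j) = unrotate H R n s z + unrotate H R n s w := by
  ext l
  simp only [unrotate_apply, PiLp.add_apply, mul_add, Finset.sum_add_distrib]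

/-- The inverse rotation is an isometry, and dropping the padded coordinates can only decrease the
norm. -/
theorem norm_sq_unrotate_le (hd : 0 < d + p) (hH : H.IsHadamard) (s : Fin (d + p) → Bool)
    (z : Fin (d + p) → ℝ) :
    ‖unrotate H R n s z‖ ^ 2
      ≤ (R * √(8 * Real.log (((d + p : ℕ) : ℝ) * n)) / √((d + p : ℕ) : ℝ)) ^ 2 * ∑ j, z j ^ 2 := by
  have h := sum_sq_mulVec (A := (rotation H s).transpose)
    (by rw [Matrix.transpose_transpose]; exact rotation_mul_transpose hd hH s) z
  rw [EuclideanSpace.norm_sq_eq, ← h, Fin.sum_univ_add, ← rotation_inv hd hH s]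
  simp only [unrotate, Real.norm_eq_abs, sq_abs, Pi.smul_apply, smul_eq_mul, mul_pow,
    ← Finset.mul_sum]
  gcongr
  simp only [le_add_iff_nonneg_right]
  exact Finset.sum_nonneg fun _ _ => sq_nonneg _

theorem unrotate_rotated (hd : 0 < d + p) (hR : 0 < R) (hH : H.IsHadamard)
    (hL : 0 < Real.log (((d + p : ℕ) : ℝ) * n)) (s : Fin (d + p) → Bool)
    (v : EuclideanSpace ℝ (Fin d)) :
    unrotate H R n s (rotated H R n s v) = v := by
  have hm : (0 : ℝ) < ((d + p : ℕ) : ℝ) := by exact_mod_cast hd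
  have h1 := Real.sqrt_pos.2 hm
  have h2 : 0 < √(8 * Real.log (((d + p : ℕ) : ℝ) * n)) := Real.sqrt_pos.2 (by positivity)
  ext l
  simp only [unrotate, rotated]
  rw [Matrix.mulVec_smul, smul_smul, Matrix.mulVec_mulVec, rotation_inv hd hH,
    transpose_mul_rotation hd hH, Matrix.one_mulVec]
  have e : R * √(8 * Real.log (((d + p : ℕ) : ℝ) * n)) / √((d + p : ℕ) : ℝ)
      * (√((d + p : ℕ) : ℝ) / (R * √(8 * Real.log (((d + p : ℕ) : ℝ) * n)))) = 1 := by
    field_simp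
  rw [e, one_smul]
  simp [padZeros]

end

/-! ### Projections of the joint law -/

theorem isProbabilityMeasure_law {n k : ℕ} (m : ℕ) (hn : 0 < n) (hk : 0 < k) :
    IsProbabilityMeasure (law n m k) := by
  have : IsProbabilityMeasure (uniformIco 0 (1 / (n : ℝ))) :=
    isProbabilityMeasure_uniformIco (by positivity)
  have : IsProbabilityMeasure (uniformIco (-(1 / (k : ℝ))) 0) :=
    isProbabilityMeasure_uniformIco (by simpa using hk)
  unfold law sharedLaw privateLaw
  infer_instance

theorem measurePreserving_signs {n k : ℕ} (m : ℕ) (hn : 0 < n) (hk : 0 < k) :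
    MeasurePreserving (fun ω : Shared n m × Private n m => ω.1.1) (law n m k) (signLaw m) := by
  have : IsProbabilityMeasure (uniformIco 0 (1 / (n : ℝ))) :=
    isProbabilityMeasure_uniformIco (by positivity)
  have : IsProbabilityMeasure (uniformIco (-(1 / (k : ℝ))) 0) :=
    isProbabilityMeasure_uniformIco (by simpa using hk)
  unfold law sharedLaw privateLaw
  exact measurePreserving_fst.comp measurePreserving_fst

/-- The signs and the randomness used in coordinate `j`. -/
def coordinateRandomness {n m : ℕ} (j : Fin m) (ω : Shared n m × Private n m) :
    ((Fin m → Bool) × ℝ) × (Equiv.Perm (Fin n) × (Fin n → ℝ)) :=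
  ((ω.1.1, ω.1.2.1 j), (ω.1.2.2 j, fun i => ω.2 i j))

/-- The other coordinates are integrated out, except for their signs, which the rotation mixes into
coordinate `j`. By Fubini the thresholds can then be averaged with signs and level fixed. -/
theorem measurePreserving_coordinateRandomness {n m k : ℕ} (hn : 0 < n) (hk : 0 < k) (j : Fin m) :
    MeasurePreserving (coordinateRandomness (n := n) j) (law n m k)
      (((signLaw m).prod (uniformIco (-(1 / (k : ℝ))) 0)).prod (thresholdLaw n)) := by
  have : IsProbabilityMeasure (uniformIco 0 (1 / (n : ℝ))) :=
    isProbabilityMeasure_uniformIco (by positivity)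
  have : IsProbabilityMeasure (uniformIco (-(1 / (k : ℝ))) 0) :=
    isProbabilityMeasure_uniformIco (by simpa using hk)
  have hc := measurePreserving_eval (fun _ : Fin m => uniformIco (-(1 / (k : ℝ))) 0) j
  have hπ := measurePreserving_eval
    (fun _ : Fin m => (PMF.uniformOfFintype (Equiv.Perm (Fin n))).toMeasure) j
  have hγ := measurePreserving_pi
    (fun _ : Fin n => Measure.pi fun _ : Fin m => uniformIco 0 (1 / (n : ℝ)))
    (fun _ : Fin n => uniformIco 0 (1 / (n : ℝ)))
    (fun _ => measurePreserving_eval (fun _ : Fin m => uniformIco 0 (1 / (n : ℝ))) j)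
  have h1 := ((MeasurePreserving.id (signLaw m)).prod (hc.prod hπ)).prod hγ
  have assoc : ∀ {α β γ : Type} [MeasurableSpace α] [MeasurableSpace β] [MeasurableSpace γ]
      (μ : Measure α) (ν : Measure β) (τ : Measure γ) [IsProbabilityMeasure μ]
      [IsProbabilityMeasure ν] [IsProbabilityMeasure τ],
      MeasurePreserving (MeasurableEquiv.prodAssoc : (α × β) × γ ≃ᵐ α × β × γ)
        ((μ.prod ν).prod τ) (μ.prod (ν.prod τ)) := fun μ ν τ _ _ _ =>
    ⟨MeasurableEquiv.prodAssoc.measurable, Measure.prodAssoc_prod⟩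
  have h2 := ((assoc (signLaw m) (uniformIco (-(1 / (k : ℝ))) 0)
    (PMF.uniformOfFintype (Equiv.Perm (Fin n))).toMeasure).symm).prod
    (MeasurePreserving.id (Measure.pi fun _ : Fin n => uniformIco 0 (1 / (n : ℝ))))
  have h3 := assoc ((signLaw m).prod (uniformIco (-(1 / (k : ℝ))) 0))
    (PMF.uniformOfFintype (Equiv.Perm (Fin n))).toMeasure
    (Measure.pi fun _ : Fin n => uniformIco 0 (1 / (n : ℝ)))
  exact h3.comp (h2.comp h1)

theorem ae_lowestLevel_mem {n m k : ℕ} (hn : 0 < n) (hk : 0 < k) :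
    ∀ᵐ ω ∂law n m k, ∀ j, ω.1.2.1 j ∈ Set.Ico (-(1 / (k : ℝ))) 0 := by
  have : IsProbabilityMeasure (uniformIco (-(1 / (k : ℝ))) 0) :=
    isProbabilityMeasure_uniformIco (by simpa using hk)
  have := isProbabilityMeasure_thresholdLaw hn
  rw [ae_all_iff]
  intro j
  have h : MeasurePreserving (fun ω : Shared n m × Private n m => ω.1.2.1 j) (law n m k)
      (uniformIco (-(1 / (k : ℝ))) 0) :=
    (measurePreserving_snd.comp measurePreserving_fst).comp
      (measurePreserving_coordinateRandomness hn hk j)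
  exact h.quasiMeasurePreserving.ae (ae_uniformIco _ _)

/-! ### Decomposition of the error into quantization noise and clipping bias -/

section

variable {n d p k : ℕ} {H : Matrix (Fin (d + p)) (Fin (d + p)) ℝ} {R : ℝ}
  {x : Fin n → EuclideanSpace ℝ (Fin d)}

/-- The clipped rotated inputs in coordinate `j`, rescaled to `[0, 1]`. -/
def unitInput (H : Matrix (Fin (d + p)) (Fin (d + p)) ℝ) (R : ℝ)
    (x : Fin n → EuclideanSpace ℝ (Fin d)) (j : Fin (d + p)) (s : Fin (d + p) → Bool)
    (i : Fin n) : ℝ :=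
  (clip (rotated H R n s (x i) j) + 1) / 2

/-- The quantization noise of the average in coordinate `j`. -/
def quantizationNoise (H : Matrix (Fin (d + p)) (Fin (d + p)) ℝ) (R : ℝ) (k : ℕ)
    (x : Fin n → EuclideanSpace ℝ (Fin d)) (j : Fin (d + p))
    (r : ((Fin (d + p) → Bool) × ℝ) × (Equiv.Perm (Fin n) × (Fin n → ℝ))) : ℝ :=
  2 * levelGap k / n * roundingError k (unitInput H R x j r.1.1) r.1.2 r.2

/-- The error of the average in coordinate `j` that is due to clipping. -/
def clippingBias (H : Matrix (Fin (d + p)) (Fin (d + p)) ℝ) (R : ℝ)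
    (x : Fin n → EuclideanSpace ℝ (Fin d)) (s : Fin (d + p) → Bool) (j : Fin (d + p)) : ℝ :=
  1 / (n : ℝ) * ∑ i, (clip (rotated H R n s (x i) j) - rotated H R n s (x i) j)

/-- The reconstructed quantization noise. -/
def noiseError (H : Matrix (Fin (d + p)) (Fin (d + p)) ℝ) (R : ℝ) (k : ℕ)
    (x : Fin n → EuclideanSpace ℝ (Fin d)) (ω : Shared n (d + p) × Private n (d + p)) :
    EuclideanSpace ℝ (Fin d) :=
  unrotate H R n ω.1.1 fun j => quantizationNoise H R k x j (coordinateRandomness j ω)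

/-- The reconstructed clipping bias. -/
def clippingError (H : Matrix (Fin (d + p)) (Fin (d + p)) ℝ) (R : ℝ)
    (x : Fin n → EuclideanSpace ℝ (Fin d)) (s : Fin (d + p) → Bool) :
    EuclideanSpace ℝ (Fin d) :=
  unrotate H R n s (clippingBias H R x s)

theorem clientQuantizer_eq_of_mem (hk : 2 ≤ k) {ω : Shared n (d + p)} (i : Fin n)
    (γ : Private n (d + p)) (j : Fin (d + p))
    (hω : ω.2.1 j ∈ Set.Ico (-(1 / (k : ℝ))) 0) :
    clientQuantizer H R k ω i (γ i) (x i) j = clip (rotated H R n ω.1 (x i) j)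
      + 2 * levelGap k * (accept (ω.2.2 j, fun i => γ i j) i
          (upperFract ((unitInput H R x j ω.1 i - ω.2.1 j) / levelGap k))
        - upperFract ((unitInput H R x j ω.1 i - ω.2.1 j) / levelGap k)) :=
  kLevelQuantizer_eq hk _ hω (neg_one_le_clip _) (clip_le_one _)

/-- The average of the quantized vectors is the rotated mean plus noise plus clipping bias, and
reconstruction is linear and inverts the scaled rotation. The null set excluded is that of levels
outside `[-1/k, 0)`. -/
theorem ae_walshHadamardCQ_eq (hn : 0 < n) (hd : 0 < d + p) (hk : 2 ≤ k) (hR : 0 < R)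
    (hH : H.IsHadamard) (hL : 0 < Real.log (((d + p : ℕ) : ℝ) * n)) :
    ∀ᵐ ω ∂law n (d + p) k, walshHadamardCQ H R k x ω
      = mean x + (noiseError H R k x ω + clippingError H R x ω.1.1) := by
  filter_upwards [ae_lowestLevel_mem (n := n) (m := d + p) hn (by omega : 0 < k)] with ω hω
  have hn' : (n : ℝ) ≠ 0 := by positivity
  have e : ∀ j, 1 / (n : ℝ) * ∑ i, clientQuantizer H R k ω.1 i (ω.2 i) (x i) j
      = rotated H R n ω.1.1 (mean x) j
        + (quantizationNoise H R k x j (coordinateRandomness j ω) + clippingBias H R x ω.1.1 j) := by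
    intro j
    simp_rw [clientQuantizer_eq_of_mem hk _ ω.2 j (hω j)]
    rw [rotated_mean, Finset.sum_add_distrib, ← Finset.mul_sum]
    unfold quantizationNoise clippingBias roundingError coordinateRandomness
    simp only [Finset.sum_sub_distrib]
    ring
  have e2 : walshHadamardCQ H R k x ω = unrotate H R n ω.1.1
      fun j => 1 / (n : ℝ) * ∑ i, clientQuantizer H R k ω.1 i (ω.2 i) (x i) j := rfl
  rw [e2]
  simp_rw [e]
  rw [unrotate_add, unrotate_add, unrotate_rotated hd hR hH hL]
  rfl

/-! ### Integrability -/

theorem measurable_coordinateRandomness {m : ℕ} (j : Fin m) :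
    Measurable (coordinateRandomness (n := n) j) := by
  unfold coordinateRandomness
  fun_prop

theorem measurable_quantizationNoise (j : Fin (d + p)) :
    Measurable (quantizationNoise H R k x j) := by
  refine Measurable.const_mul (measurable_roundingError k (fun i => ?_) ?_ measurable_snd) _
  · exact (measurable_of_countable fun s => unitInput H R x j s i).comp
      (measurable_fst.comp measurable_fst)
  · exact measurable_snd.comp measurable_fst

theorem abs_quantizationNoise_le (hn : 0 < n) (hk : 2 ≤ k) (j : Fin (d + p))
    (r : ((Fin (d + p) → Bool) × ℝ) × (Equiv.Perm (Fin n) × (Fin n → ℝ))) :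
    |quantizationNoise H R k x j r| ≤ 2 * levelGap k := by
  have hn' : (0 : ℝ) < n := by exact_mod_cast hn
  have hβ := levelGap_pos hk
  unfold quantizationNoise
  rw [abs_mul, abs_of_nonneg (by positivity)]
  calc _ ≤ 2 * levelGap k / n * n := by gcongr; exact abs_roundingError_le _ _ _ _
    _ = _ := by field_simp

theorem noiseError_apply (ω : Shared n (d + p) × Private n (d + p)) (l : Fin d) :
    noiseError H R k x ω l
      = ∑ j, (R * √(8 * Real.log (((d + p : ℕ) : ℝ) * n)) / √((d + p : ℕ) : ℝ)
        * (rotation H ω.1.1)⁻¹ (Fin.castAdd p l) j)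
          * quantizationNoise H R k x j (coordinateRandomness j ω) :=
  unrotate_apply _ _ _

theorem measurable_noiseError : Measurable (noiseError H R k x) := by
  have h : Measurable fun ω : Shared n (d + p) × Private n (d + p) =>
      fun l => noiseError H R k x ω l := by
    refine measurable_pi_lambda _ fun l => ?_
    simp_rw [noiseError_apply]
    refine Finset.measurable_sum _ fun j _ => Measurable.mul ?_
      ((measurable_quantizationNoise j).comp (measurable_coordinateRandomness j))
    exact (measurable_of_countable fun s : Fin (d + p) → Bool =>
      R * √(8 * Real.log (((d + p : ℕ) : ℝ) * n)) / √((d + p : ℕ) : ℝ)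
        * (rotation H s)⁻¹ (Fin.castAdd p l) j).comp (measurable_fst.comp measurable_fst)
  exact (WithLp.measurable_toLp 2 (Fin d → ℝ)).comp h

theorem memLp_noiseError (hn : 0 < n) (hd : 0 < d + p) (hk : 2 ≤ k) (hH : H.IsHadamard) :
    MemLp (noiseError H R k x) 2 (law n (d + p) k) := by
  have := isProbabilityMeasure_law (d + p) hn (by omega : 0 < k)
  refine MemLp.of_bound measurable_noiseError.aestronglyMeasurable
    (√((R * √(8 * Real.log (((d + p : ℕ) : ℝ) * n)) / √((d + p : ℕ) : ℝ)) ^ 2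
      * ∑ _j : Fin (d + p), (2 * levelGap k) ^ 2)) (Filter.Eventually.of_forall fun ω => ?_)
  refine Real.le_sqrt_of_sq_le ((norm_sq_unrotate_le hd hH _ _).trans ?_)
  refine mul_le_mul_of_nonneg_left (Finset.sum_le_sum fun j _ => ?_) (sq_nonneg _)
  exact sq_le_sq' (neg_le_of_abs_le (abs_quantizationNoise_le hn hk j _))
    (le_of_abs_le (abs_quantizationNoise_le hn hk j _))

theorem memLp_clippingError (hn : 0 < n) (hk : 2 ≤ k) :
    MemLp (fun ω => clippingError H R x ω.1.1) 2 (law n (d + p) k) :=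
  MemLp.comp_measurePreserving (g := clippingError H R x) .of_discrete
    (measurePreserving_signs (d + p) hn (by omega : 0 < k))

/-! ### The noise has mean zero -/

/-- The inverse rotation depends on the signs only, so it factors out of the average over the
thresholds, which is zero. -/
theorem integral_noiseError (hn : 0 < n) (hd : 0 < d + p) (hk : 2 ≤ k) (hH : H.IsHadamard) :
    ∫ ω, noiseError H R k x ω ∂law n (d + p) k = 0 := by
  have hk0 : 0 < k := by omega
  have := isProbabilityMeasure_law (d + p) hn hk0
  have := isProbabilityMeasure_thresholdLaw hn
  have : IsProbabilityMeasure (uniformIco (-(1 / (k : ℝ))) 0) :=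
    isProbabilityMeasure_uniformIco (by simpa using hk0)
  have hint : Integrable (noiseError H R k x) (law n (d + p) k) :=
    (memLp_noiseError hn hd hk hH).integrable one_le_two
  ext l
  have e : ∫ ω, noiseError H R k x ω l ∂law n (d + p) k
      = (∫ ω, noiseError H R k x ω ∂law n (d + p) k) l :=
    (EuclideanSpace.proj (𝕜 := ℝ) l).integral_comp_comm hint
  rw [← e, PiLp.zero_apply]
  simp_rw [noiseError_apply]
  set F : Fin (d + p) → ((Fin (d + p) → Bool) × ℝ) × (Equiv.Perm (Fin n) × (Fin n → ℝ)) → ℝ :=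
    fun j r => (R * √(8 * Real.log (((d + p : ℕ) : ℝ) * n)) / √((d + p : ℕ) : ℝ)
        * (rotation H r.1.1)⁻¹ (Fin.castAdd p l) j) * quantizationNoise H R k x j r with hF
  have hmeas : ∀ j, Measurable (F j) := fun j =>
    Measurable.mul ((measurable_of_countable fun s : Fin (d + p) → Bool =>
      R * √(8 * Real.log (((d + p : ℕ) : ℝ) * n)) / √((d + p : ℕ) : ℝ)
        * (rotation H s)⁻¹ (Fin.castAdd p l) j).comp (measurable_fst.comp measurable_fst))
      (measurable_quantizationNoise j)
  have hFint : ∀ j, Integrable (F j)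
      (((signLaw (d + p)).prod (uniformIco (-(1 / (k : ℝ))) 0)).prod (thresholdLaw n)) := by
    intro j
    -- There are finitely many sign vectors, so the coefficients are bounded.
    obtain ⟨C, hC⟩ := Finite.bddAbove_range fun s : Fin (d + p) → Bool =>
      |R * √(8 * Real.log (((d + p : ℕ) : ℝ) * n)) / √((d + p : ℕ) : ℝ)
        * (rotation H s)⁻¹ (Fin.castAdd p l) j|
    refine integrable_of_bdd (hmeas j) (C * (2 * levelGap k)) fun r => ?_
    rw [hF, abs_mul]
    exact mul_le_mul (hC ⟨r.1.1, rfl⟩) (abs_quantizationNoise_le hn hk j r) (abs_nonneg _)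
      ((abs_nonneg _).trans (hC ⟨r.1.1, rfl⟩))
  have hmp := fun j : Fin (d + p) => measurePreserving_coordinateRandomness (n := n) hn hk0 j
  change ∫ ω, ∑ j, F j (coordinateRandomness j ω) ∂law n (d + p) k = 0
  rw [integral_finsetSum (f := fun j ω => F j (coordinateRandomness j ω)) _ fun j _ =>
    (hmp j).integrable_comp_of_integrable (hFint j)]
  refine Finset.sum_eq_zero fun j _ => ?_
  rw [← integral_map (hmp j).measurable.aemeasurable (hmeas j).aestronglyMeasurable, (hmp j).map_eq,
    integral_prod _ (hFint j)]
  simp only [hF, quantizationNoise, integral_const_mul, integral_roundingError hn, mul_zero,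
    integral_zero]

/-! ### Second moments -/

theorem integral_sq_quantizationNoise_le (hn : 0 < n) (hk : 2 ≤ k) (j : Fin (d + p)) :
    ∫ ω, quantizationNoise H R k x j (coordinateRandomness j ω) ^ 2 ∂law n (d + p) k
      ≤ ∫ s, (2 * levelGap k / n) ^ 2 * (2 + 1 / n * ∑ i, ∑ i',
        min (1 / 4) (|unitInput H R x j s i - unitInput H R x j s i'| / levelGap k))
        ∂signLaw (d + p) := by
  have hk0 : 0 < k := by omega
  have := isProbabilityMeasure_law (d + p) hn hk0
  have := isProbabilityMeasure_thresholdLaw hn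
  have : IsProbabilityMeasure (uniformIco (-(1 / (k : ℝ))) 0) :=
    isProbabilityMeasure_uniformIco (by simpa using hk0)
  have hmp := measurePreserving_coordinateRandomness (n := n) hn hk0 j
  have hmeas : Measurable fun r => quantizationNoise H R k x j r ^ 2 :=
    (measurable_quantizationNoise j).pow_const 2
  have hint : Integrable (fun r => quantizationNoise H R k x j r ^ 2)
      (((signLaw (d + p)).prod (uniformIco (-(1 / (k : ℝ))) 0)).prod (thresholdLaw n)) := by
    refine integrable_of_bdd hmeas ((2 * levelGap k) ^ 2) fun r => ?_
    rw [abs_pow]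
    exact pow_le_pow_left₀ (abs_nonneg _) (abs_quantizationNoise_le hn hk j r) 2
  rw [← integral_map (f := fun r => quantizationNoise H R k x j r ^ 2)
    hmp.measurable.aemeasurable hmeas.aestronglyMeasurable, hmp.map_eq, integral_prod _ hint]
  set G : (Fin (d + p) → Bool) → ℝ := fun s => (2 * levelGap k / n) ^ 2 * (2 + 1 / n * ∑ i, ∑ i',
        min (1 / 4) (|unitInput H R x j s i - unitInput H R x j s i'| / levelGap k)) with hG
  have hGint : Integrable G (signLaw (d + p)) := .of_finite
  calc _ ≤ ∫ r, G r.1 ∂(signLaw (d + p)).prod (uniformIco (-(1 / (k : ℝ))) 0) := by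
        refine integral_mono hint.integral_prod_left (hGint.comp_fst _) fun r => ?_
        simp only [quantizationNoise, mul_pow, integral_const_mul, hG]
        gcongr
        exact integral_sq_roundingError_le hn hk _ _
    _ = _ := by rw [integral_fun_fst, probReal_univ, one_smul]

/-- Clipping is 1-Lipschitz and rescaling halves distances; the triangle inequality passes through
the rotated mean. Cauchy-Schwarz over the `m` coordinates costs `√m`, which joins the `√m` of the
scaling. -/
theorem sum_abs_unitInput_sub_le (hd : 0 < d + p) (hn : 0 < n) (hR : 0 < R) (hH : H.IsHadamard)
    (s : Fin (d + p) → Bool) :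
    ∑ j, ∑ i, ∑ i', |unitInput H R x j s i - unitInput H R x j s i'|
      ≤ (n : ℝ) ^ 2 * ((d + p : ℕ) : ℝ) / (R * √(8 * Real.log (((d + p : ℕ) : ℝ) * n)))
        * meanDeviation x := by
  have hn' : (n : ℝ) ≠ 0 := by positivity
  set Y : Fin n → Fin (d + p) → ℝ := fun i => rotated H R n s (x i - mean x) with hY
  have h1 : ∀ j i i', |unitInput H R x j s i - unitInput H R x j s i'|
      ≤ 1 / 2 * |Y i j| + 1 / 2 * |Y i' j| := by
    intro j i i'
    have e1 : unitInput H R x j s i - unitInput H R x j s i'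
        = (clip (rotated H R n s (x i) j) - clip (rotated H R n s (x i') j)) / 2 := by
      unfold unitInput; ring
    have h2 := abs_clip_sub_clip_le (rotated H R n s (x i) j) (rotated H R n s (x i') j)
    have e2 : rotated H R n s (x i) j - rotated H R n s (x i') j = Y i j - Y i' j := by
      simp only [hY, rotated_sub]; ring
    rw [e2] at h2
    have h3 := abs_sub (Y i j) (Y i' j)
    rw [e1, abs_div, abs_two]
    linarith
  have h2 : ∀ i, ∑ j, |Y i j| ≤ ((d + p : ℕ) : ℝ)
      / (R * √(8 * Real.log (((d + p : ℕ) : ℝ) * n))) * ‖x i - mean x‖ := by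
    intro i
    have h3 := sum_sq_rotated (n := n) (R := R) hd hH s (x i - mean x)
    have h4 := sq_sum_le_card_mul_sum_sq (s := Finset.univ) (f := fun j => |Y i j|)
    simp only [sq_abs, Finset.card_univ, Fintype.card_fin] at h4
    refine abs_le_of_sq_le_sq' (h4.trans (le_of_eq ?_)) (by positivity) |>.2
    rw [h3, mul_pow, mul_pow, div_pow, div_pow, Real.sq_sqrt (Nat.cast_nonneg _)]
    ring
  calc _ ≤ ∑ j, ∑ i, ∑ i', (1 / 2 * |Y i j| + 1 / 2 * |Y i' j|) := by
        gcongr with j _ i _ i' _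
        exact h1 j i i'
    _ = n * ∑ i, ∑ j, |Y i j| := by
        rw [Finset.sum_comm (s := (Finset.univ : Finset (Fin n)))
          (t := (Finset.univ : Finset (Fin (d + p)))), Finset.mul_sum]
        refine Finset.sum_congr rfl fun j _ => ?_
        simp only [Finset.sum_add_distrib, Finset.sum_const, Finset.card_univ, Fintype.card_fin,
          nsmul_eq_mul, ← Finset.mul_sum]
        ring
    _ ≤ n * ∑ i, ((d + p : ℕ) : ℝ)
        / (R * √(8 * Real.log (((d + p : ℕ) : ℝ) * n))) * ‖x i - mean x‖ := by
        gcongr with i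
        exact h2 i
    _ = _ := by
        rw [← Finset.mul_sum, meanDeviation]
        field_simp

theorem sum_integral_sq_quantizationNoise_le (hd : 0 < d + p) (hn : 0 < n) (hk : 2 ≤ k)
    (hR : 0 < R) (hH : H.IsHadamard) :
    ∑ j, ∫ ω, quantizationNoise H R k x j (coordinateRandomness j ω) ^ 2 ∂law n (d + p) k
      ≤ (2 * levelGap k / n) ^ 2 * (2 * ((d + p : ℕ) : ℝ) + min (n * ((d + p : ℕ) : ℝ) / 4)
        (n * ((d + p : ℕ) : ℝ) / (R * √(8 * Real.log (((d + p : ℕ) : ℝ) * n)) * levelGap k)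
          * meanDeviation x)) := by
  have hn' : (n : ℝ) ≠ 0 := by positivity
  have hβ := levelGap_pos hk
  refine (Finset.sum_le_sum fun j _ => integral_sq_quantizationNoise_le hn hk j).trans ?_
  rw [← integral_finsetSum _ fun j _ => .of_finite]
  refine (integral_mono (μ := signLaw (d + p)) (g := fun _ => (2 * levelGap k / n) ^ 2
    * (2 * ((d + p : ℕ) : ℝ) + min (n * ((d + p : ℕ) : ℝ) / 4)
        (n * ((d + p : ℕ) : ℝ) / (R * √(8 * Real.log (((d + p : ℕ) : ℝ) * n)) * levelGap k)
          * meanDeviation x))) .of_finite .of_finite fun s => ?_).trans (by simp)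
  simp only [← Finset.mul_sum, Finset.sum_add_distrib]
  gcongr
  · simp [mul_comm]
  refine le_min ?_ ?_
  · calc _ ≤ 1 / (n : ℝ) * ∑ _j : Fin (d + p), ∑ _i : Fin n, ∑ _i' : Fin n, (1 / 4 : ℝ) := by
          gcongr
          exact min_le_left _ _
      _ = _ := by simp; field_simp
  · calc _ ≤ 1 / (n : ℝ) * ∑ j, ∑ i, ∑ i',
          |unitInput H R x j s i - unitInput H R x j s i'| / levelGap k := by
          gcongr
          exact min_le_right _ _
      _ = 1 / (n : ℝ) / levelGap k * ∑ j, ∑ i, ∑ i',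
          |unitInput H R x j s i - unitInput H R x j s i'| := by
          simp only [← Finset.sum_div]
          ring
      _ ≤ 1 / (n : ℝ) / levelGap k * ((n : ℝ) ^ 2 * ((d + p : ℕ) : ℝ)
          / (R * √(8 * Real.log (((d + p : ℕ) : ℝ) * n))) * meanDeviation x) := by
          gcongr
          exact sum_abs_unitInput_sub_le hd hn hR hH s
      _ = _ := by field_simp

/-- Cauchy-Schwarz over the clients reduces this to one Rademacher sum, with `exp(-4 log(mn)) =
(mn)⁻⁴`. -/
theorem integral_sq_clippingBias_le (hd : 0 < d + p) (hn : 0 < n) (hR : 0 < R)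
    (hH : H.IsHadamard) (hL : 0 < Real.log (((d + p : ℕ) : ℝ) * n)) (hx : ∀ i, ‖x i‖ ≤ R)
    (j : Fin (d + p)) :
    ∫ s, clippingBias H R x s j ^ 2 ∂signLaw (d + p)
      ≤ 1 / (16 * Real.log (((d + p : ℕ) : ℝ) * n) ^ 2) * (1 / (((d + p : ℕ) : ℝ) * n) ^ 4) := by
  have hn' : (0 : ℝ) < n := by exact_mod_cast hn
  have hm : (0 : ℝ) < ((d + p : ℕ) : ℝ) := by exact_mod_cast hd
  have h1 : ∀ s, clippingBias H R x s j ^ 2 ≤ 1 / (n : ℝ) * ∑ i,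
      (clip (rotated H R n s (x i) j) - rotated H R n s (x i) j) ^ 2 := by
    intro s
    have h := sq_sum_le_card_mul_sum_sq (s := Finset.univ)
      (f := fun i => clip (rotated H R n s (x i) j) - rotated H R n s (x i) j)
    simp only [Finset.card_univ, Fintype.card_fin] at h
    unfold clippingBias
    rw [mul_pow]
    refine (mul_le_mul_of_nonneg_left h (sq_nonneg _)).trans (le_of_eq ?_)
    field_simp
  refine (integral_mono (μ := signLaw (d + p)) .of_finite .of_finite h1).trans ?_
  rw [integral_const_mul, integral_finsetSum _ fun i _ => .of_finite]
  have e : Real.exp (-(4 * Real.log (((d + p : ℕ) : ℝ) * n))) = 1 / (((d + p : ℕ) : ℝ) * n) ^ 4 := by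
    rw [Real.exp_neg, one_div]
    congr 1
    have := Real.exp_nat_mul (Real.log (((d + p : ℕ) : ℝ) * n)) 4
    rw [Real.exp_log (by positivity)] at this
    exact_mod_cast this
  rw [← e]
  calc _ ≤ 1 / (n : ℝ) * ∑ _i : Fin n, 1 / (16 * Real.log (((d + p : ℕ) : ℝ) * n) ^ 2)
        * Real.exp (-(4 * Real.log (((d + p : ℕ) : ℝ) * n))) := by
        gcongr with i
        obtain ⟨a, ha, ha2⟩ := rotated_eq_rademacher (H := H) hd hR hH hL (hx i) j
        simp_rw [ha]
        exact integral_sq_clip_rademacher_sub_le a hL ha2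
    _ = _ := by simp; field_simp

theorem integral_sq_norm_clippingError_le (hd : 0 < d + p) (hn : 0 < n) (hR : 0 < R)
    (hH : H.IsHadamard) (hL : 0 < Real.log (((d + p : ℕ) : ℝ) * n)) (hx : ∀ i, ‖x i‖ ≤ R) :
    ∫ s, ‖clippingError H R x s‖ ^ 2 ∂signLaw (d + p)
      ≤ R ^ 2 / (2 * Real.log (((d + p : ℕ) : ℝ) * n) * (((d + p : ℕ) : ℝ) * n) ^ 4) := by
  have hm : (0 : ℝ) < ((d + p : ℕ) : ℝ) := by exact_mod_cast hd
  have hn' : (0 : ℝ) < n := by exact_mod_cast hn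
  calc _ ≤ ∫ s, (R * √(8 * Real.log (((d + p : ℕ) : ℝ) * n)) / √((d + p : ℕ) : ℝ)) ^ 2
        * ∑ j, clippingBias H R x s j ^ 2 ∂signLaw (d + p) :=
        integral_mono .of_finite .of_finite fun s => norm_sq_unrotate_le hd hH s _
    _ = (R ^ 2 * (8 * Real.log (((d + p : ℕ) : ℝ) * n)) / ((d + p : ℕ) : ℝ))
        * ∑ j, ∫ s, clippingBias H R x s j ^ 2 ∂signLaw (d + p) := by
        rw [integral_const_mul, integral_finsetSum _ fun j _ => .of_finite, div_pow, mul_pow,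
          Real.sq_sqrt (by positivity), Real.sq_sqrt hm.le]
    _ ≤ (R ^ 2 * (8 * Real.log (((d + p : ℕ) : ℝ) * n)) / ((d + p : ℕ) : ℝ))
        * ∑ _j : Fin (d + p), 1 / (16 * Real.log (((d + p : ℕ) : ℝ) * n) ^ 2)
          * (1 / (((d + p : ℕ) : ℝ) * n) ^ 4) := by
        gcongr with j
        exact integral_sq_clippingBias_le hd hn hR hH hL hx j
    _ = _ := by
        rw [Finset.sum_const, Finset.card_univ, Fintype.card_fin, nsmul_eq_mul]
        field_simp
        norm_num

end

/-! ### Bias and mean squared error -/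

section

variable {n d p k : ℕ} {H : Matrix (Fin (d + p)) (Fin (d + p)) ℝ} {R : ℝ}
  {x : Fin n → EuclideanSpace ℝ (Fin d)}

theorem half_le_log (hdn : 2 ≤ d * n) : 1 / 2 ≤ Real.log ((d : ℝ) * n) := by
  have h2 : (2 : ℝ) ≤ d * n := by exact_mod_cast hdn
  have := Real.log_le_log (by norm_num) h2
  linarith [Real.log_two_gt_d9]

theorem log_le_log_padded (hdn : 2 ≤ d * n) :
    Real.log ((d : ℝ) * n) ≤ Real.log (((d + p : ℕ) : ℝ) * n) := by
  have h2 : (2 : ℝ) ≤ d * n := by exact_mod_cast hdn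
  refine Real.log_le_log (by linarith) ?_
  gcongr
  omega

/-- Padding at most doubles the dimension, and `2 d n ≤ (d n)²`. -/
theorem log_padded_le (hdn : 2 ≤ d * n) (hp : p < d) :
    Real.log (((d + p : ℕ) : ℝ) * n) ≤ 2 * Real.log ((d : ℝ) * n) := by
  have h2 : (2 : ℝ) ≤ d * n := by exact_mod_cast hdn
  have hp' : (p : ℝ) ≤ d := by exact_mod_cast hp.le
  have hn : 0 < n := Nat.pos_of_ne_zero (by rintro rfl; simp at hdn)
  have hd : 0 < d := by omega
  have e : 2 * Real.log ((d : ℝ) * n) = Real.log (((d : ℝ) * n) ^ 2) := by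
    rw [Real.log_pow]; norm_num
  rw [e]
  refine Real.log_le_log (by positivity) ?_
  push_cast
  calc ((d : ℝ) + p) * n ≤ (d + d) * n := by gcongr
    _ = 2 * (d * n) := by ring
    _ ≤ (d * n) ^ 2 := by rw [sq]; gcongr

theorem meanDeviation_nonneg (x : Fin n → EuclideanSpace ℝ (Fin d)) : 0 ≤ meanDeviation x := by
  unfold meanDeviation
  positivity

theorem memLp_walshHadamardCQ (hn : 0 < n) (hd : 0 < d + p) (hk : 2 ≤ k) (hR : 0 < R)
    (hH : H.IsHadamard) (hL : 0 < Real.log (((d + p : ℕ) : ℝ) * n)) :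
    MemLp (walshHadamardCQ H R k x) 2 (law n (d + p) k) := by
  have := isProbabilityMeasure_law (d + p) hn (by omega : 0 < k)
  refine MemLp.ae_eq (Filter.EventuallyEq.symm (ae_walshHadamardCQ_eq hn hd hk hR hH hL))
    (MemLp.add (memLp_const _) (MemLp.add (memLp_noiseError hn hd hk hH)
      (memLp_clippingError hn hk)))

theorem integral_clippingError_comp (hn : 0 < n) (hk : 2 ≤ k) :
    ∫ ω, ‖clippingError H R x ω.1.1‖ ^ 2 ∂law n (d + p) k
      = ∫ s, ‖clippingError H R x s‖ ^ 2 ∂signLaw (d + p) := by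
  have hmp := measurePreserving_signs (n := n) (d + p) hn (by omega : 0 < k)
  rw [← hmp.map_eq, integral_map hmp.measurable.aemeasurable
    (measurable_of_countable _).aestronglyMeasurable]

theorem norm_integral_walshHadamardCQ_sub_sq_le (hn : 0 < n) (hd : 0 < d + p) (hk : 2 ≤ k)
    (hR : 0 < R) (hH : H.IsHadamard) (hL : 0 < Real.log (((d + p : ℕ) : ℝ) * n))
    (hx : ∀ i, ‖x i‖ ≤ R) :
    ‖(∫ ω, walshHadamardCQ H R k x ω ∂law n (d + p) k) - mean x‖ ^ 2
      ≤ R ^ 2 / (2 * Real.log (((d + p : ℕ) : ℝ) * n) * (((d + p : ℕ) : ℝ) * n) ^ 4) := by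
  have := isProbabilityMeasure_law (d + p) hn (by omega : 0 < k)
  have hN := (memLp_noiseError (x := x) (R := R) hn hd hk hH).integrable one_le_two
  have hC2 := memLp_clippingError (x := x) (R := R) (H := H) hn hk
  have hC := hC2.integrable one_le_two
  have e : (∫ ω, walshHadamardCQ H R k x ω ∂law n (d + p) k) - mean x
      = ∫ ω, clippingError H R x ω.1.1 ∂law n (d + p) k := by
    rw [integral_congr_ae (ae_walshHadamardCQ_eq hn hd hk hR hH hL),
      integral_add (g := fun ω => noiseError H R k x ω + clippingError H R x ω.1.1)
        (integrable_const _) (hN.add hC), integral_add hN hC,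
      integral_noiseError hn hd hk hH]
    simp
  rw [e]
  refine le_trans ?_ (integral_sq_norm_clippingError_le hd hn hR hH hL hx)
  rw [← integral_clippingError_comp hn hk]
  calc _ ≤ (∫ ω, ‖clippingError H R x ω.1.1‖ ∂law n (d + p) k) ^ 2 := by
        gcongr
        exact norm_integral_le_integral_norm _
    _ ≤ _ := by
        -- Nonnegativity of the variance of the norm is the inequality `(E‖·‖)² ≤ E‖·‖²`.
        have h1 := variance_nonneg (fun ω => ‖clippingError H R x ω.1.1‖) (law n (d + p) k)
        rw [variance_eq_sub hC2.norm] at h1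
        exact sub_nonneg.1 h1

theorem integral_sq_norm_noiseError_le (hn : 0 < n) (hd : 0 < d + p) (hk : 2 ≤ k) (hR : 0 < R)
    (hH : H.IsHadamard) (hL : 1 / 2 ≤ Real.log (((d + p : ℕ) : ℝ) * n)) :
    ∫ ω, ‖noiseError H R k x ω‖ ^ 2 ∂law n (d + p) k
      ≤ Real.log (((d + p : ℕ) : ℝ) * n) / n * (72 * min (meanDeviation x * R / k)
        (R ^ 2 / (k : ℝ) ^ 2) + 576 * (R ^ 2 / (n * (k : ℝ) ^ 2))) := by
  have := isProbabilityMeasure_law (d + p) hn (by omega : 0 < k)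
  have hn' : (0 : ℝ) < n := by exact_mod_cast hn
  have hk' : (0 : ℝ) < k := by exact_mod_cast (by omega : 0 < k)
  have hm : (0 : ℝ) < ((d + p : ℕ) : ℝ) := by exact_mod_cast hd
  have hβ := levelGap_pos hk
  have hβ3 := levelGap_le hk
  have hσ := meanDeviation_nonneg x
  have hsum := sum_integral_sq_quantizationNoise_le (x := x) hd hn hk hR hH
  have hqint : ∀ j, Integrable
      (fun ω => quantizationNoise H R k x j (coordinateRandomness j ω) ^ 2) (law n (d + p) k) := by
    intro j
    refine integrable_of_bdd (((measurable_quantizationNoise j).comp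
      (measurable_coordinateRandomness j)).pow_const 2) ((2 * levelGap k) ^ 2) fun ω => ?_
    rw [abs_pow]
    exact pow_le_pow_left₀ (abs_nonneg _) (abs_quantizationNoise_le hn hk j _) 2
  set L := Real.log (((d + p : ℕ) : ℝ) * n) with hLdef
  set m := ((d + p : ℕ) : ℝ) with hmdef
  set σ := meanDeviation x
  set β := levelGap k
  have hL0 : 0 < L := by linarith
  -- This bound removes the root of the logarithm from the denominator of the mean deviation term.
  have hsq : 2 ≤ √(8 * L) := Real.le_sqrt_of_sq_le (by linarith)
  have hsqsq : √(8 * L) ^ 2 = 8 * L := Real.sq_sqrt (by linarith)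
  have h1 : ∫ ω, ‖noiseError H R k x ω‖ ^ 2 ∂law n (d + p) k
      ≤ R ^ 2 * (8 * L) / m * ∑ j, ∫ ω, quantizationNoise H R k x j (coordinateRandomness j ω) ^ 2
        ∂law n (d + p) k := by
    rw [← integral_finsetSum _ fun j _ => hqint j, ← integral_const_mul]
    refine integral_mono (memLp_noiseError hn hd hk hH).integrable_norm_pow'
      ((integrable_finsetSum _ fun j _ => hqint j).const_mul _) fun ω => ?_
    refine (norm_sq_unrotate_le hd hH _ _).trans (le_of_eq ?_)
    rw [div_pow, mul_pow, Real.sq_sqrt (by positivity), Real.sq_sqrt hm.le]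
  have h2 : R ^ 2 * (8 * L) / m * ((2 * β / n) ^ 2 * (2 * m + min (n * m / 4)
      (n * m / (R * √(8 * L) * β) * σ)))
      = L / n * (min (8 * R ^ 2 * β ^ 2) (32 * R * σ * β / √(8 * L)) + 64 * R ^ 2 * β ^ 2 / n) := by
    have e : ∀ a b : ℝ, R ^ 2 * (8 * L) / m * ((2 * β / n) ^ 2 * (2 * m + min a b))
        = L / n * (min ((32 * R ^ 2 * β ^ 2 / (n * m)) * a) ((32 * R ^ 2 * β ^ 2 / (n * m)) * b)
          + 64 * R ^ 2 * β ^ 2 / n) := by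
      intro a b
      rw [← mul_min_of_nonneg _ _ (by positivity)]
      field_simp
      ring
    rw [e]
    congr 3
    · field_simp; norm_num
    · field_simp
  -- With `β ≤ 3/k` the branches have constants `8 · 9 = 72` and `32 · 3 / 2 = 48`.
  have hmin : min (8 * R ^ 2 * β ^ 2) (32 * R * σ * β / √(8 * L))
      ≤ 72 * min (σ * R / k) (R ^ 2 / (k : ℝ) ^ 2) := by
    rw [mul_min_of_nonneg _ _ (by norm_num), min_comm]
    refine min_le_min ?_ ?_
    · calc _ ≤ 32 * R * σ * (3 / k) / 2 := by gcongr
        _ = 48 * (σ * R / k) := by ring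
        _ ≤ _ := by gcongr; norm_num
    · calc _ ≤ 8 * R ^ 2 * (3 / k) ^ 2 := by gcongr
        _ = _ := by ring
  have hlast : 64 * R ^ 2 * β ^ 2 / n ≤ 576 * (R ^ 2 / (n * (k : ℝ) ^ 2)) := by
    calc _ ≤ 64 * R ^ 2 * (3 / k) ^ 2 / n := by gcongr
      _ = _ := by field_simp; norm_num
  calc _ ≤ R ^ 2 * (8 * L) / m * ((2 * β / n) ^ 2 * (2 * m + min (n * m / 4)
      (n * m / (R * √(8 * L) * β) * σ))) := h1.trans (by gcongr)
    _ ≤ _ := by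
      rw [h2]
      gcongr

theorem integral_sq_norm_walshHadamardCQ_sub_le (hn : 0 < n) (hd : 0 < d + p) (hk : 2 ≤ k)
    (hR : 0 < R) (hH : H.IsHadamard) (hL : 0 < Real.log (((d + p : ℕ) : ℝ) * n)) :
    ∫ ω, ‖walshHadamardCQ H R k x ω - mean x‖ ^ 2 ∂law n (d + p) k
      ≤ 2 * ∫ ω, ‖noiseError H R k x ω‖ ^ 2 ∂law n (d + p) k
        + 2 * ∫ s, ‖clippingError H R x s‖ ^ 2 ∂signLaw (d + p) := by
  have := isProbabilityMeasure_law (d + p) hn (by omega : 0 < k)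
  have hN := memLp_noiseError (x := x) (R := R) hn hd hk hH
  have hC := memLp_clippingError (x := x) (R := R) (H := H) hn hk
  have hN2 : Integrable (fun ω => ‖noiseError H R k x ω‖ ^ 2) (law n (d + p) k) :=
    hN.integrable_norm_pow'
  have hC2 : Integrable (fun ω => ‖clippingError H R x ω.1.1‖ ^ 2) (law n (d + p) k) :=
    hC.integrable_norm_pow'
  rw [← integral_clippingError_comp hn hk, ← integral_const_mul, ← integral_const_mul,
    ← integral_add (hN2.const_mul 2) (hC2.const_mul 2)]
  refine integral_mono_ae
    ((memLp_walshHadamardCQ hn hd hk hR hH hL).sub (memLp_const _)).integrable_norm_pow'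
    ((hN2.const_mul 2).add (hC2.const_mul 2)) ?_
  filter_upwards [ae_walshHadamardCQ_eq (x := x) hn hd hk hR hH hL] with ω hω
  rw [hω, add_sub_cancel_left]
  have h1 := norm_add_le (noiseError H R k x ω) (clippingError H R x ω.1.1)
  have h2 := norm_nonneg (noiseError H R k x ω + clippingError H R x ω.1.1)
  nlinarith [sq_nonneg (‖noiseError H R k x ω‖ - ‖clippingError H R x ω.1.1‖)]

/-- Since `log(mn) ≥ log(dn) ≥ 1/2`, the logarithm in the denominator can be dropped and the factor
`2 log(dn) ≥ 1` inserted; one power of `d` is given away. -/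
theorem clipping_bound_le (hdn : 2 ≤ d * n) :
    R ^ 2 / (2 * Real.log (((d + p : ℕ) : ℝ) * n) * (((d + p : ℕ) : ℝ) * n) ^ 4)
      ≤ 2 * Real.log ((d : ℝ) * n) / n * (R ^ 2 / ((n : ℝ) ^ 3 * (d : ℝ) ^ 3)) := by
  have hn : 0 < n := Nat.pos_of_ne_zero (by rintro rfl; simp at hdn)
  have hd : 0 < d := Nat.pos_of_ne_zero (by rintro rfl; simp at hdn)
  have hn' : (1 : ℝ) ≤ n := by exact_mod_cast hn
  have hd' : (1 : ℝ) ≤ d := by exact_mod_cast hd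
  have h1 := half_le_log hdn
  have h2 := log_le_log_padded (p := p) hdn
  have hm : (d : ℝ) ≤ ((d + p : ℕ) : ℝ) := by exact_mod_cast Nat.le_add_right d p
  calc _ ≤ R ^ 2 / (2 * (1 / 2) * ((d : ℝ) * n) ^ 4) := by gcongr <;> linarith
    _ = R ^ 2 / ((n : ℝ) ^ 4 * (d : ℝ) ^ 4) := by congr 1; ring
    _ ≤ R ^ 2 / ((n : ℝ) ^ 4 * (d : ℝ) ^ 3) := by
        gcongr 3
        norm_num
    _ = 2 * (1 / 2) / n * (R ^ 2 / ((n : ℝ) ^ 3 * (d : ℝ) ^ 3)) := by field_simp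
    _ ≤ _ := by gcongr

theorem norm_integral_walshHadamardCQ_sub_le (hdn : 2 ≤ d * n) (hk : 2 ≤ k) (hR : 0 < R)
    (hH : H.IsHadamard) (hx : ∀ i, ‖x i‖ ≤ R) :
    ‖(∫ ω, walshHadamardCQ H R k x ω ∂law n (d + p) k) - mean x‖
      ≤ 3 * R * √(2 * Real.log ((d : ℝ) * n)) / ((n : ℝ) ^ 2 * (d : ℝ) ^ (3 / 2 : ℝ)) := by
  have hn : 0 < n := Nat.pos_of_ne_zero (by rintro rfl; simp at hdn)
  have hd : 0 < d := Nat.pos_of_ne_zero (by rintro rfl; simp at hdn)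
  have h1 := half_le_log hdn
  have h2 := log_le_log_padded (p := p) hdn
  have hL : 0 < Real.log (((d + p : ℕ) : ℝ) * n) := by linarith
  have hsq := (norm_integral_walshHadamardCQ_sub_sq_le hn (by omega) hk hR hH hL hx).trans
    (clipping_bound_le hdn)
  have hd32 : ((d : ℝ) ^ (3 / 2 : ℝ)) ^ 2 = (d : ℝ) ^ 3 := by
    rw [← Real.rpow_natCast, ← Real.rpow_mul (Nat.cast_nonneg d), ← Real.rpow_natCast]
    norm_num
  refine (abs_le_of_sq_le_sq' (hsq.trans ?_) (by positivity)).2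
  rw [div_pow, mul_pow, mul_pow, mul_pow, hd32, Real.sq_sqrt (by positivity)]
  calc _ = 2 * (R ^ 2 * Real.log ((d : ℝ) * n)) / (n ^ 4 * (d : ℝ) ^ 3) := by field_simp
    -- The square of the claimed bound carries `3² · 2 = 18`; only `2` is needed.
    _ ≤ 18 * (R ^ 2 * Real.log ((d : ℝ) * n)) / (n ^ 4 * (d : ℝ) ^ 3) := by
        gcongr
        norm_num
    _ = _ := by ring

theorem integral_sq_error_le (hdn : 2 ≤ d * n) (hp : p < d) (hk : 2 ≤ k) (hR : 0 < R)
    (hH : H.IsHadamard) (hx : ∀ i, ‖x i‖ ≤ R) :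
    ∫ ω, ‖walshHadamardCQ H R k x ω - mean x‖ ^ 2 ∂law n (d + p) k
      ≤ 2304 * Real.log ((d : ℝ) * n) / n * (min (meanDeviation x * R / k) (R ^ 2 / (k : ℝ) ^ 2)
        + R ^ 2 / (n * (k : ℝ) ^ 2) + R ^ 2 / ((n : ℝ) ^ 3 * (d : ℝ) ^ 3)) := by
  have hn : 0 < n := Nat.pos_of_ne_zero (by rintro rfl; simp at hdn)
  have hd : 0 < d := Nat.pos_of_ne_zero (by rintro rfl; simp at hdn)
  have h1 := half_le_log hdn
  have h2 := log_le_log_padded (p := p) hdn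
  have h3 := log_padded_le hdn hp
  have hL : 0 < Real.log (((d + p : ℕ) : ℝ) * n) := by linarith
  have hσ := meanDeviation_nonneg x
  have hmse := integral_sq_norm_walshHadamardCQ_sub_le (x := x) hn (by omega) hk hR hH hL
  have hN := integral_sq_norm_noiseError_le (x := x) hn (by omega) hk hR hH (by linarith)
  have hC := (integral_sq_norm_clippingError_le (by omega) hn hR hH hL hx).trans
    (clipping_bound_le (p := p) (R := R) hdn)
  set L := Real.log (((d + p : ℕ) : ℝ) * n)
  set l := Real.log ((d : ℝ) * n)
  have hA : 0 ≤ min (meanDeviation x * R / k) (R ^ 2 / (k : ℝ) ^ 2) :=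
    le_min (by positivity) (by positivity)
  have hB : 0 ≤ R ^ 2 / (n * (k : ℝ) ^ 2) := by positivity
  have hD : 0 ≤ R ^ 2 / ((n : ℝ) ^ 3 * (d : ℝ) ^ 3) := by positivity
  set A := min (meanDeviation x * R / k) (R ^ 2 / (k : ℝ) ^ 2)
  set B := R ^ 2 / (n * (k : ℝ) ^ 2)
  set D := R ^ 2 / ((n : ℝ) ^ 3 * (d : ℝ) ^ 3)
  have hl : 0 ≤ l / n := by positivity
  have hN' : L / n * (72 * A + 576 * B) ≤ 2 * l / n * (72 * A + 576 * B) := by gcongr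
  have e1 : 2 * l / n * (72 * A + 576 * B) = l / n * A * 144 + l / n * B * 1152 := by ring
  have e2 : 2 * l / n * D = l / n * D * 2 := by ring
  -- The term `B` dictates the constant: `576` is doubled by `log(mn) ≤ 2 log(dn)` and again by `‖u
  -- + v‖² ≤ 2‖u‖² + 2‖v‖²`.
  have e3 : 2304 * l / n * (A + B + D) = l / n * A * 2304 + l / n * B * 2304 + l / n * D * 2304 := by
    ring
  have := mul_nonneg hl hA
  have := mul_nonneg hl hB
  have := mul_nonneg hl hD
  linarith

/-! ### Encoding of the quantized vectors -/

theorem exists_fixed_length_code (m : ℕ) (hk : 2 ≤ k) :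
    ∃ L : ℕ, (L : ℝ) ≤ (m : ℝ) * Real.logb 2 k + 1 ∧
      Nonempty ((Fin m → Fin k) ↪ (Fin L → Bool)) := by
  have hk' : (1 : ℝ) ≤ k := by exact_mod_cast (by omega : 1 ≤ k)
  have h0 : 0 ≤ (m : ℝ) * Real.logb 2 k :=
    mul_nonneg (Nat.cast_nonneg _) (Real.logb_nonneg (by norm_num) hk')
  refine ⟨⌈(m : ℝ) * Real.logb 2 k⌉₊, (Nat.ceil_lt_add_one h0).le, ?_⟩
  refine Function.Embedding.nonempty_of_card_le ?_
  simp only [Fintype.card_fun, Fintype.card_fin, Fintype.card_bool]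
  have h1 : (k : ℝ) ^ m ≤ 2 ^ ⌈(m : ℝ) * Real.logb 2 k⌉₊ := by
    rw [← Real.rpow_natCast 2]
    calc (k : ℝ) ^ m = 2 ^ ((m : ℝ) * Real.logb 2 k) := by
          rw [mul_comm, Real.rpow_mul (by norm_num), Real.rpow_logb (by norm_num) (by norm_num)
            (by linarith), Real.rpow_natCast]
      _ ≤ _ := Real.rpow_le_rpow_of_exponent_le (by norm_num) (Nat.le_ceil _)
  exact_mod_cast h1

theorem exists_code (hn : 0 < n) (hk : 2 ≤ k) (H : Matrix (Fin (d + p)) (Fin (d + p)) ℝ) (R : ℝ) :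
    ∃ L : ℕ, (L : ℝ) ≤ ((d + p : ℕ) : ℝ) * Real.logb 2 k + 1 ∧
      ∃ (enc : Shared n (d + p) → (Fin (d + p) → ℝ) → (Fin L → Bool))
        (dec : Shared n (d + p) → (Fin L → Bool) → (Fin (d + p) → ℝ)),
        ∀ x : Fin n → EuclideanSpace ℝ (Fin d), ∀ᵐ ω ∂law n (d + p) k, ∀ i,
          dec ω.1 (enc ω.1 (clientQuantizer H R k ω.1 i (ω.2 i) (x i)))
            = clientQuantizer H R k ω.1 i (ω.2 i) (x i) := by
  obtain ⟨L, hL, ⟨e⟩⟩ := exists_fixed_length_code (k := k) (d + p) hk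
  have : Nonempty (Fin (d + p) → Fin k) := ⟨fun _ => ⟨0, by omega⟩⟩
  set lev : Shared n (d + p) → (Fin (d + p) → Fin k) → (Fin (d + p) → ℝ) :=
    fun ω a j => -1 + 2 * level k (ω.2.1 j) (a j) with hlev
  -- The encoder sends some index vector whose levels form `q`, and the decoder recomputes those
  -- levels from the shared randomness. On vectors not made of levels `Function.invFun` returns a
  -- default, which matters only on a null set.
  refine ⟨L, hL, fun ω q => e (Function.invFun (lev ω) q),
    fun ω b => lev ω (Function.invFun e b), fun x => ?_⟩
  filter_upwards [ae_lowestLevel_mem (n := n) (m := d + p) hn (by omega : 0 < k)] with ω hω i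
  rw [Function.leftInverse_invFun e.injective]
  refine Function.invFun_eq ?_
  have h : ∀ j, ∃ a : Fin k, clientQuantizer H R k ω.1 i (ω.2 i) (x i) j
      = -1 + 2 * level k (ω.1.2.1 j) a := fun j =>
    exists_kLevelQuantizer_eq_level hk _ (hω j) (neg_one_le_clip _) (clip_le_one _)
  choose a ha using h
  exact ⟨a, funext fun j => (ha j).symm⟩

end

end CorrelatedQuantization

end

theorem corollary2 :
    ∃ c : ℝ, 0 < c ∧
      ∀ (n d p k : ℕ) (R : ℝ) (H : Matrix (Fin (d + p)) (Fin (d + p)) ℝ),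
        2 ≤ d * n → p < d → 2 ≤ k → 0 < R → H.IsHadamard →
        -- bias and mean squared error
        (∀ x : Fin n → EuclideanSpace ℝ (Fin d), (∀ i, x i ∈ Metric.closedBall 0 R) →
          MemLp (CorrelatedQuantization.walshHadamardCQ H R k x) 2
              (CorrelatedQuantization.law n (d + p) k) ∧
          ‖(∫ ω, CorrelatedQuantization.walshHadamardCQ H R k x ω
                ∂(CorrelatedQuantization.law n (d + p) k)) - CorrelatedQuantization.mean x‖
            ≤ 3 * R * √(2 * Real.log ((d : ℝ) * n)) / ((n : ℝ) ^ 2 * (d : ℝ) ^ (3 / 2 : ℝ)) ∧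
          ∫ ω, ‖CorrelatedQuantization.walshHadamardCQ H R k x ω
                  - CorrelatedQuantization.mean x‖ ^ 2
                ∂(CorrelatedQuantization.law n (d + p) k)
            ≤ c * Real.log ((d : ℝ) * n) / n *
                (min (CorrelatedQuantization.meanDeviation x * R / k) (R ^ 2 / (k : ℝ) ^ 2)
                  + R ^ 2 / (n * (k : ℝ) ^ 2) + R ^ 2 / ((n : ℝ) ^ 3 * (d : ℝ) ^ 3))) ∧
        -- communication: bit strings of a fixed length `L`, from which the server recovers
        -- the quantized vector of every client by means of the shared randomness
        (∃ L : ℕ, (L : ℝ) ≤ ((d + p : ℕ) : ℝ) * Real.logb 2 k + 1 ∧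
          ∃ (enc : CorrelatedQuantization.Shared n (d + p) → (Fin (d + p) → ℝ) → (Fin L → Bool))
            (dec : CorrelatedQuantization.Shared n (d + p) → (Fin L → Bool) → (Fin (d + p) → ℝ)),
            ∀ x : Fin n → EuclideanSpace ℝ (Fin d), (∀ i, x i ∈ Metric.closedBall 0 R) →
              ∀ᵐ ω ∂(CorrelatedQuantization.law n (d + p) k), ∀ i,
                dec ω.1 (enc ω.1
                    (CorrelatedQuantization.clientQuantizer H R k ω.1 i (ω.2 i) (x i)))
                  = CorrelatedQuantization.clientQuantizer H R k ω.1 i (ω.2 i) (x i)) := by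
  refine ⟨2304, by norm_num, fun n d p k R H hdn hp hk hR hH => ⟨fun x hx => ?_, ?_⟩⟩
  · have hn : 0 < n := Nat.pos_of_ne_zero (by rintro rfl; simp at hdn)
    have hx' : ∀ i, ‖x i‖ ≤ R := fun i => mem_closedBall_zero_iff.1 (hx i)
    have hL : 0 < Real.log (((d + p : ℕ) : ℝ) * n) := by
      linarith [CorrelatedQuantization.half_le_log hdn,
        CorrelatedQuantization.log_le_log_padded (p := p) hdn]
    exact ⟨CorrelatedQuantization.memLp_walshHadamardCQ hn (by omega) hk hR hH hL,
      CorrelatedQuantization.norm_integral_walshHadamardCQ_sub_le hdn hk hR hH hx',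
      CorrelatedQuantization.integral_sq_error_le hdn hp hk hR hH hx'⟩
  · have hn : 0 < n := Nat.pos_of_ne_zero (by rintro rfl; simp at hdn)
    obtain ⟨L, hL, enc, dec, h⟩ := CorrelatedQuantization.exists_code hn hk H R
    exact ⟨L, hL, enc, dec, fun x _ => h x⟩
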